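/- Let $n\ge 2$ and let $M,M'$ be connected $n$-dimensional $C^\infty$ manifolds (Hausdorff, second countable, without boundary) with Finsler structures $F,F'$. Here a Finsler structure on $M$ is a function $F\ge 0$ that is $C^\infty$ on $TM_0=TM\setminus\{0\}$, satisfies $F(x,\lambda y)=\lambda F(x,y)$ for $\lambda>0$, and for which $g_{ij}(x,y)=\tfrac12\,\partial^2F^2/\partial y^i\partial y^j$ is positive definite on $TM_0$; write $g_{y}$ for the resulting inner product on $T_xM$, $y\in T_xM\setminus\{0\}$, and $g^{ij}$ for the inverse matrix. *Sphere bundle.* $SM$ is the bundle of rays $[y]=\{\lambda y:\lambda>0\}$, $y\in T_xM\setminus\{0\}$. With $C_{ijk}=\tfrac12\,\partial g_{ij}/\partial y^k$, $\gamma^i_{jk}=\tfrac12 g^{is}\big(\tfrac{\partial g_{sj}}{\partial x^k}-\tfrac{\partial g_{jk}}{\partial x^s}+\tfrac{\partial g_{ks}}{\partial x^j}\big)$, $N^i_j=\gamma^i_{jk}y^k-C^i_{jk}\gamma^k_{rs}y^ry^s$ and $\delta y^i=dy^i+N^i_j\,dx^j$, it carries the Sasaki metric $\tilde g=g_{ij}\,dx^i\otimes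 dx^j+g_{ij}\,\tfrac{\delta y^i}{F}\otimes\tfrac{\delta y^j}{F}$, with respect to which gradients and their norms are taken. The Hilbert form is $\omega=g_{ij}\tfrac{y^j}{F}\,dx^i$, and $$\eta(g)=\frac{(-1)^{n(n-1)/2}}{(n-1)!}\,\omega\wedge(d\omega)^{n-1}$$ is the volume element of $SM$; $SM$ is oriented by $\eta(g)$. *Energy and capacity.* For $u:M\to\mathbb R$ let $u^V([y])=u(x)$ for $y\in T_xM\setminus\{0\}$ (vertical lift). Let $H(M)$ be the set of continuous $u:M\to\mathbb R$ that have a generalized (weak) differential, with components in $L^n$ on compact subsets of coordinate domains, and satisfy $$I(u,M)=\int_{SM}|\nabla u^V|^n\,\eta(g)<\infty ,$$ where the differential of $u^V$ is the pull-back to $SM$ of the weak differential of $u$. Let $H_0(M)$ be the set of $u\in H(M)$ such that $u^V$ has compact support in $SM$. For compact $C\subset M$ put $$\mathrm{Cap}_M(C)=\inf\{I(u,M): u\in H_0(M),\ u=1\text{ on }C,\ 0\le u\le 1\},$$ and for closed $C_0,C_1\subset M$ put $$\mathrm{Cap}_M(C_0,C_1)=\inf\{I(u,M): u\in H(M),\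 u=0\text{ on }C_0,\ u=1\text{ on }C_1,\ 0\le u\le 1\},$$ with $\inf\emptyset=+\infty$. **Theorem.** Let $f:M\to M'$ be a conformal ($C^\infty$) diffeomorphism, that is, one whose differential preserves angles: for all $x\in M$ and nonzero $y,a,b\in T_xM$, the angle between $a$ and $b$ with respect to $g_{y}$ equals the angle between $f_*a$ and $f_*b$ with respect to $g'_{f_*y}$. Then $$\mathrm{Cap}_M(C)=\mathrm{Cap}_{M'}(f(C)),\qquad \mathrm{Cap}_M(C_0,C_1)=\mathrm{Cap}_{M'}(f(C_0),f(C_1))$$ for every compact subset $C$ and all closed subsets $C_0,C_1$ of $M$. -/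

import Mathlib

open scoped Manifold ContDiff
open MeasureTheory

noncomputable section

/-- The model space `ℝⁿ`. -/
abbrev Eu (n : ℕ) : Type := EuclideanSpace ℝ (Fin n)

/-- The standard basis vectors of `ℝⁿ`. -/
abbrev stdVec {n : ℕ} (i : Fin n) : Eu n := EuclideanSpace.single i (1 : ℝ)

section Finsler

variable {n : ℕ} {M : Type*} [TopologicalSpace M] [ChartedSpace (Eu n) M]

/-- For a function `F` on the tangent bundle, `fundForm F v a` is the linear form
`b ↦ g_v(a, b)` on `T_xM`, where `g_v(a, b) = (1/2) ∂_b ∂_a (F²|_{T_xM})` at `v ∈ T_xM`; in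
coordinates `g_{ij} = (1/2) (F²)_{y^i y^j}`. -/
def fundForm (F : TangentBundle (𝓡 n) M → ℝ) (v : TangentBundle (𝓡 n) M)
    (a : TangentSpace (𝓡 n) v.proj) : TangentSpace (𝓡 n) v.proj →L[ℝ] ℝ :=
  (1 / 2 : ℝ) • fderiv ℝ (fun y : TangentSpace (𝓡 n) v.proj =>
    fderiv ℝ (fun w : TangentSpace (𝓡 n) v.proj => F ⟨v.proj, w⟩ ^ 2) y a) v.snd

variable (n M) in
/-- A (positively homogeneous, smooth, strongly convex) Finsler structure on `M`. All conditions
concern the tangent bundle without its zero section; values on the zero section play no role. -/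
structure FinslerStructure [IsManifold (𝓡 n) ∞ M] where
  /-- the Finsler function `F` -/
  toFun : TangentBundle (𝓡 n) M → ℝ
  nonneg : ∀ v, v.snd ≠ 0 → 0 ≤ toFun v
  smooth : ContMDiffOn (𝓡 n).tangent 𝓘(ℝ, ℝ) ∞ toFun {v | v.snd ≠ 0}
  homogeneous : ∀ (x : M) (y : TangentSpace (𝓡 n) x), y ≠ 0 → ∀ t : ℝ, 0 < t →
    toFun ⟨x, t • y⟩ = t * toFun ⟨x, y⟩
  posDef : ∀ v, v.snd ≠ 0 → ∀ a, a ≠ 0 → 0 < fundForm toFun v a a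

/-- The angle between `a, b ∈ T_xM` measured by the inner product `g_v`, `v ∈ T_xM ∖ 0`. -/
def finslerAngle (F : TangentBundle (𝓡 n) M → ℝ) (v : TangentBundle (𝓡 n) M)
    (a b : TangentSpace (𝓡 n) v.proj) : ℝ :=
  Real.arccos (fundForm F v a b / (√(fundForm F v a a) * √(fundForm F v b b)))

/-! ### The sphere bundle -/

/-- The complement of the zero section in the tangent bundle. -/
def SlitTangent (n : ℕ) (M : Type*) [TopologicalSpace M] [ChartedSpace (Eu n) M] : Type _ :=
  {v : TangentBundle (𝓡 n) M // v.snd ≠ 0}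

/-- Two nonzero tangent vectors are equivalent if they span the same ray. -/
def raySetoid (n : ℕ) (M : Type*) [TopologicalSpace M] [ChartedSpace (Eu n) M] :
    Setoid (SlitTangent n M) where
  r v w := ∃ t : ℝ, 0 < t ∧ w.1 = ⟨v.1.proj, t • v.1.snd⟩
  iseqv := by
    refine ⟨fun v => ⟨1, one_pos, by simp⟩, ?_, ?_⟩
    · rintro ⟨⟨x, y⟩, hv⟩ ⟨w, hw⟩ ⟨t, ht, h⟩
      dsimp only at h
      subst h
      exact ⟨t⁻¹, inv_pos.2 ht, by simp [smul_smul, ht.ne']⟩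
    · rintro ⟨⟨x, y⟩, hv⟩ ⟨w, hw⟩ ⟨w', hw'⟩ ⟨t, ht, h⟩ ⟨s, hs, h'⟩
      dsimp only at h
      subst h
      dsimp only at h'
      subst h'
      exact ⟨s * t, mul_pos hs ht, by simp [smul_smul]⟩

/-- The sphere bundle `SM`: the set of rays `[y]`, `y ∈ T_xM ∖ 0`, `x ∈ M`. -/
def SphereBundle (n : ℕ) (M : Type*) [TopologicalSpace M] [ChartedSpace (Eu n) M] : Type _ :=
  Quotient (raySetoid n M)

instance [IsManifold (𝓡 n) ∞ M] : TopologicalSpace (SlitTangent n M) :=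
  inferInstanceAs (TopologicalSpace {v : TangentBundle (𝓡 n) M // v.snd ≠ 0})

instance [IsManifold (𝓡 n) ∞ M] : TopologicalSpace (SphereBundle n M) :=
  inferInstanceAs (TopologicalSpace (Quotient (raySetoid n M)))

instance [IsManifold (𝓡 n) ∞ M] : MeasurableSpace (SphereBundle n M) := borel _

/-- The ray `[y]` of a nonzero tangent vector. -/
def ray (v : TangentBundle (𝓡 n) M) (hv : v.snd ≠ 0) : SphereBundle n M :=
  Quotient.mk (raySetoid n M) ⟨v, hv⟩

/-- A nonzero tangent vector spanning the given ray. -/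
def SphereBundle.rep (s : SphereBundle n M) : TangentBundle (𝓡 n) M :=
  (Quotient.out (s := raySetoid n M) s).1

/-- The projection `p : SM → M`. -/
def SphereBundle.proj (s : SphereBundle n M) : M := s.rep.proj

/-- The vertical lift `u^V` of `u`, as a function on `SM`. -/
def verticalLift (u : M → ℝ) : SphereBundle n M → ℝ := fun s => u s.proj

/-! ### Induced coordinates on the tangent bundle -/

/-- The differential at `x` of the parametrization `e.symm` inverse to a chart `e`. -/
def chartInvDeriv (e : OpenPartialHomeomorph M (Eu n)) (x : Eu n) :
    Eu n →L[ℝ] TangentSpace (𝓡 n) (e.symm x) :=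
  mfderiv (𝓡 n) (𝓡 n) e.symm x

/-- The tangent vector with induced coordinates `(x, y)` in the chart `e`, namely
`y^i ∂/∂x^i` at the point with coordinates `x`. -/
def tangentOfCoord (e : OpenPartialHomeomorph M (Eu n)) (p : Eu n × Eu n) :
    TangentBundle (𝓡 n) M :=
  ⟨e.symm p.1, chartInvDeriv e p.1 p.2⟩

/-- The induced coordinates `(x, y)` of a tangent vector in the chart `e`. -/
def coordOfTangent (e : OpenPartialHomeomorph M (Eu n)) (v : TangentBundle (𝓡 n) M) :
    Eu n × Eu n :=
  (e v.proj, mfderiv (𝓡 n) (𝓡 n) e v.proj v.snd)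

theorem chartInvDeriv_ne_zero [IsManifold (𝓡 n) ∞ M] {e : OpenPartialHomeomorph M (Eu n)}
    (he : e ∈ IsManifold.maximalAtlas (𝓡 n) ∞ M) {x : Eu n} (hx : x ∈ e.target)
    {y : Eu n} (hy : y ≠ 0) : chartInvDeriv e x y ≠ 0 := by
  have hd : e.MDifferentiable (𝓡 n) (𝓡 n) :=
    ⟨(contMDiffOn_of_mem_maximalAtlas he).mdifferentiableOn (by simp),
      (contMDiffOn_symm_of_mem_maximalAtlas he).mdifferentiableOn (by simp)⟩
  exact fun h => hy (hd.symm.mfderiv_injective hx (h.trans (map_zero _).symm))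

/-! ### The Sasaki metric in induced coordinates -/

section Sasaki

variable (F : TangentBundle (𝓡 n) M → ℝ) (e : OpenPartialHomeomorph M (Eu n)) (p : Eu n × Eu n)

/-- `g_{ij}(x, y)`. -/
def gMat : Matrix (Fin n) (Fin n) ℝ := fun i j =>
  fundForm F (tangentOfCoord e p) (chartInvDeriv e p.1 (stdVec i))
    (chartInvDeriv e p.1 (stdVec j))

/-- `g^{ij}(x, y)`. -/
def gInv : Matrix (Fin n) (Fin n) ℝ := (gMat F e p)⁻¹

/-- `∂ g_{ij} / ∂ x^k`. -/
def dxG (i j k : Fin n) : ℝ := fderiv ℝ (fun q => gMat F e q i j) p (stdVec k, 0)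

/-- The Cartan tensor `C_{ijk} = (1/2) ∂ g_{ij} / ∂ y^k`. -/
def cartan (i j k : Fin n) : ℝ := (1 / 2) * fderiv ℝ (fun q => gMat F e q i j) p (0, stdVec k)

/-- `C^i_{jk} = g^{is} C_{sjk}`. -/
def cartanUp (i j k : Fin n) : ℝ := ∑ s, gInv F e p i s * cartan F e p s j k

/-- `γ^i_{jk} = (1/2) g^{is} (∂_k g_{sj} - ∂_s g_{jk} + ∂_j g_{ks})`. -/
def christoffel (i j k : Fin n) : ℝ :=
  (1 / 2) * ∑ s, gInv F e p i s * (dxG F e p s j k - dxG F e p j k s + dxG F e p k s j)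

/-- Coefficients of the nonlinear connection,
`N^i_j = γ^i_{jk} y^k - C^i_{jk} γ^k_{rs} y^r y^s`. -/
def nonlinConn (i j : Fin n) : ℝ :=
  ∑ k, christoffel F e p i j k * p.2 k -
    ∑ k, ∑ r, ∑ s, cartanUp F e p i j k * christoffel F e p k r s * p.2 r * p.2 s

/-- The frame vector `δ/δx^i = ∂/∂x^i - N^j_i ∂/∂y^j`, in induced coordinates. -/
def deltaX (i : Fin n) : Eu n × Eu n :=
  (stdVec i, -∑ j, nonlinConn F e p j i • stdVec j)

/-- The frame vector `F ∂/∂y^i`, in induced coordinates. -/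
def fDeltaY (i : Fin n) : Eu n × Eu n := (0, F (tangentOfCoord e p) • stdVec i)

/-- The covector `δy^i / F = (dy^i + N^i_j dx^j) / F`. -/
def deltaY (i : Fin n) (X : Eu n × Eu n) : ℝ :=
  (X.2 i + ∑ j, nonlinConn F e p i j * X.1 j) / F (tangentOfCoord e p)

/-- The Sasaki metric `g_{ij} dx^i ⊗ dx^j + g_{ij} (δy^i/F) ⊗ (δy^j/F)` at `(x, y)`. -/
def sasaki (X Y : Eu n × Eu n) : ℝ :=
  ∑ i, ∑ j, gMat F e p i j * X.1 i * Y.1 j +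
    ∑ i, ∑ j, gMat F e p i j * deltaY F e p i X * deltaY F e p j Y

/-- The gradient, for the Sasaki metric at `(x, y)`, of a function with differential `α`:
`g^{ij} α(δ/δx^i) δ/δx^j + g^{ij} α(F ∂/∂y^i) F ∂/∂y^j`. For a function on the sphere bundle, that
is, a function that is invariant under `y ↦ t y`, `t > 0`, this is the gradient on `SM`. -/
def sasakiGrad (α : Eu n × Eu n →L[ℝ] ℝ) : Eu n × Eu n :=
  ∑ i, ∑ j, (gInv F e p i j * α (deltaX F e p i)) • deltaX F e p j +
    ∑ i, ∑ j, (gInv F e p i j * α (fDeltaY F e p i)) • fDeltaY F e p j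

/-- The norm of the gradient of a function with differential `α`, for the Sasaki metric. -/
def sasakiGradNorm (α : Eu n × Eu n →L[ℝ] ℝ) : ℝ :=
  √(sasaki F e p (sasakiGrad F e p α) (sasakiGrad F e p α))

/-- The defining property of the gradient: `g̃(∇, X) = α(X)` for all `X`. -/
theorem sasaki_sasakiGrad (hg : IsUnit (gMat F e p).det) (hF : F (tangentOfCoord e p) ≠ 0)
    (α : Eu n × Eu n →L[ℝ] ℝ) (X : Eu n × Eu n) :
    sasaki F e p (sasakiGrad F e p α) X = α X := by
  have hinv : ∀ i k, ∑ j, gInv F e p i j * gMat F e p j k = if i = k then 1 else 0 := fun i k => by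
    have := congrFun (congrFun (Matrix.nonsing_inv_mul _ hg) i) k
    rwa [Matrix.mul_apply, Matrix.one_apply] at this
  have key : ∀ a b : Fin n → ℝ, ∑ j, ∑ k, gMat F e p j k * (∑ i, gInv F e p i j * a i) * b k =
      ∑ k, a k * b k := fun a b => by
    have : ∀ k, ∑ j, gMat F e p j k * (∑ i, gInv F e p i j * a i) = a k := fun k => by
      have : ∑ i, a i * ∑ j, gInv F e p i j * gMat F e p j k = a k := by simp [hinv]
      rw [← this]
      simp only [Finset.mul_sum]
      rw [Finset.sum_comm]
      exact Finset.sum_congr rfl fun i _ => Finset.sum_congr rfl fun j _ => by ring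
    rw [Finset.sum_comm]
    exact Finset.sum_congr rfl fun k _ => by rw [← Finset.sum_mul, this]
  have h1 : ∀ j, (sasakiGrad F e p α).1 j = ∑ i, gInv F e p i j * α (deltaX F e p i) := fun j => by
    simp [sasakiGrad, deltaX, fDeltaY, Prod.fst_sum, Pi.single_apply]
  have h2 : ∀ j, deltaY F e p j (sasakiGrad F e p α) =
      ∑ i, gInv F e p i j * α (fDeltaY F e p i) := fun j => by
    rw [deltaY, div_eq_iff hF]
    simp only [h1]
    simp [sasakiGrad, deltaX, fDeltaY, Prod.snd_sum, Pi.single_apply]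
    simp only [Finset.mul_sum, Finset.sum_mul]
    rw [Finset.sum_comm (s := Finset.univ) (t := Finset.univ)]
    have : ∀ a b c : ℝ, a = b → -a + c + b = c := fun a b c h => by rw [h]; ring
    apply this
    refine Finset.sum_congr rfl fun i _ => Finset.sum_congr rfl fun k _ => ?_
    ring
  have hX : X = ∑ i, X.1 i • deltaX F e p i + ∑ i, deltaY F e p i X • fDeltaY F e p i := by
    ext j
    · simp [deltaX, fDeltaY, Prod.fst_sum, Pi.single_apply]
    · simp [deltaX, fDeltaY, Prod.snd_sum, Pi.single_apply, deltaY, div_mul_cancel₀ _ hF]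
      simp [mul_comm]
  rw [sasaki]
  simp only [h1, h2]
  rw [key, key]
  conv_rhs => rw [hX]
  simp [mul_comm]

end Sasaki

/-- Pull-back along the projection to `M` of a covector field `D` on `M`, at the tangent vector with
induced coordinates `p = (x, y)`. If `D` is the differential of `u`, this is the differential of
the vertical lift `u^V`. -/
def liftCovector (D : ∀ x : M, TangentSpace (𝓡 n) x →L[ℝ] ℝ)
    (e : OpenPartialHomeomorph M (Eu n)) (p : Eu n × Eu n) : Eu n × Eu n →L[ℝ] ℝ :=
  (D (e.symm p.1)).comp ((chartInvDeriv e p.1).comp (ContinuousLinearMap.fst ℝ (Eu n) (Eu n)))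

/-- `|∇ u^V|` as a function on `SM`, where `D` is the differential of `u`. It is computed in the
coordinates induced by the preferred chart at the base point and at a representative of the ray; the
value depends on neither choice. -/
def gradNorm (F : TangentBundle (𝓡 n) M → ℝ) (D : ∀ x : M, TangentSpace (𝓡 n) x →L[ℝ] ℝ)
    (s : SphereBundle n M) : ℝ :=
  sasakiGradNorm F (chartAt (Eu n) s.proj) (coordOfTangent (chartAt (Eu n) s.proj) s.rep)
    (liftCovector D (chartAt (Eu n) s.proj) (coordOfTangent (chartAt (Eu n) s.proj) s.rep))

/-! ### Hilbert form and the volume element -/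

/-- The Hilbert form `ω = l_i dx^i = g_{ij} (y^j / F) dx^i` at `(x, y)`, as a covector on `T_xM`. It
depends only on the ray of `y`. -/
def hilbertForm (F : TangentBundle (𝓡 n) M → ℝ) (v : TangentBundle (𝓡 n) M) :
    TangentSpace (𝓡 n) v.proj →L[ℝ] ℝ :=
  fundForm F v ((F v)⁻¹ • v.snd)

/-- Coordinates on `{(x, [y]) : ε y^k > 0}`, where `ε = ±1`: the coordinates of `x` together with
`y^j / |y^k|`, `j ≠ k`. -/
abbrev RayCoord (n : ℕ) (k : Fin n) : Type := Eu n × ({j : Fin n // j ≠ k} → ℝ)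

/-- The direction `y` with `y^k = ε` and with other components `z`. -/
def rayVec {n : ℕ} (k : Fin n) (ε : ℤˣ) (z : {j : Fin n // j ≠ k} → ℝ) : Eu n :=
  WithLp.toLp 2 fun j => if h : j = k then ((ε : ℤ) : ℝ) else z ⟨j, h⟩

theorem rayVec_ne_zero {n : ℕ} (k : Fin n) (ε : ℤˣ) (z : {j : Fin n // j ≠ k} → ℝ) :
    rayVec k ε z ≠ 0 := by
  intro h
  have h1 := congrArg (fun v : Eu n => v k) h
  simp [rayVec] at h1

/-- The tangent vector with ray coordinates `w`, normalized by `y^k = ε`. -/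
def rayTangent (e : OpenPartialHomeomorph M (Eu n)) (k : Fin n) (ε : ℤˣ) (w : RayCoord n k) :
    TangentBundle (𝓡 n) M :=
  tangentOfCoord e (w.1, rayVec k ε w.2)

/-- The Hilbert form of `SM` in ray coordinates, as a differential 1-form. -/
def hilbertLocal (F : TangentBundle (𝓡 n) M → ℝ) (e : OpenPartialHomeomorph M (Eu n))
    (k : Fin n) (ε : ℤˣ) (w : RayCoord n k) : RayCoord n k [⋀^Fin 1]→L[ℝ] ℝ :=
  ContinuousAlternatingMap.ofSubsingleton ℝ (RayCoord n k) ℝ (0 : Fin 1)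
    ((hilbertForm F (rayTangent e k ε w)).comp
      ((chartInvDeriv e w.1).comp
        (ContinuousLinearMap.fst ℝ (Eu n) ({j : Fin n // j ≠ k} → ℝ))))

/-- The value of the wedge product `α ∧ β ∧ ⋯ ∧ β` (`m` factors `β`) of a 1-form and 2-forms on
vectors `v_0, …, v_{2m}`:
`(1 / (1! (2!)^m)) ∑_σ sgn(σ) α(v_{σ 0}) ∏_{i < m} β(v_{σ(2i+1)}, v_{σ(2i+2)})`. -/
def wedgePow {V : Type*} [NormedAddCommGroup V] [NormedSpace ℝ V] (m : ℕ)
    (α : V [⋀^Fin 1]→L[ℝ] ℝ) (β : V [⋀^Fin 2]→L[ℝ] ℝ) (v : Fin (2 * m + 1) → V) : ℝ :=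
  (2 ^ m : ℝ)⁻¹ * ∑ σ : Equiv.Perm (Fin (2 * m + 1)),
    ((Equiv.Perm.sign σ : ℤ) : ℝ) * α ![v (σ 0)] *
      ∏ i : Fin m, β ![v (σ ⟨2 * i.1 + 1, by omega⟩), v (σ ⟨2 * i.1 + 2, by omega⟩)]

theorem card_rayIndex {n : ℕ} (k : Fin n) :
    Fintype.card (Fin (2 * (n - 1) + 1)) = Fintype.card (Fin n ⊕ {j : Fin n // j ≠ k}) := by
  have := k.pos
  simp [Fintype.card_subtype_compl]
  omega

/-- The coordinate frame of the ray coordinates (in some order). -/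
def rayFrame {n : ℕ} (k : Fin n) (i : Fin (2 * (n - 1) + 1)) : RayCoord n k :=
  Sum.elim (fun i => (stdVec i, 0)) (fun j => (0, Pi.single j 1))
    (Fintype.equivOfCardEq (card_rayIndex k) i)

/-- The coefficient of the volume element
`η = ((-1)^{n(n-1)/2} / (n-1)!) ω ∧ (dω)^{n-1}` in ray coordinates (up to the sign that comes from
the order of the coordinates). -/
def volCoeff (F : TangentBundle (𝓡 n) M → ℝ) (e : OpenPartialHomeomorph M (Eu n))
    (k : Fin n) (ε : ℤˣ) (w : RayCoord n k) : ℝ :=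
  ((-1) ^ (n * (n - 1) / 2) / (Nat.factorial (n - 1) : ℝ)) *
    wedgePow (n - 1) (hilbertLocal F e k ε w) (extDeriv (hilbertLocal F e k ε) w) (rayFrame k)

/-- The parametrization of an open subset of `SM` by ray coordinates. -/
def rayParam [IsManifold (𝓡 n) ∞ M] (e : IsManifold.maximalAtlas (𝓡 n) ∞ M) (k : Fin n) (ε : ℤˣ)
    (w : {w : RayCoord n k // w.1 ∈ e.1.target}) : SphereBundle n M :=
  ray (rayTangent e.1 k ε w.1) (chartInvDeriv_ne_zero e.2 w.2 (rayVec_ne_zero k ε w.1.2))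

/-- The measure of the volume element `η` on one coordinate domain of `SM`: in coordinates it is
`|coefficient of η|` times Lebesgue measure. -/
def localVolume [IsManifold (𝓡 n) ∞ M] (F : TangentBundle (𝓡 n) M → ℝ)
    (e : IsManifold.maximalAtlas (𝓡 n) ∞ M) (k : Fin n) (ε : ℤˣ) : Measure (SphereBundle n M) :=
  Measure.map (rayParam e k ε)
    (Measure.comap Subtype.val
      ((volume : Measure (RayCoord n k)).withDensity
        fun w => ENNReal.ofReal |volCoeff F e.1 k ε w|))

/-- The measure on `SM` given by integration of the volume element `η` (with `SM` oriented by `η`).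
It is the least measure that dominates `localVolume` on all coordinate domains. As local volumes agree
on overlaps and countably many coordinate domains cover `SM`, this is the measure which restricts to
`localVolume` on each coordinate domain. -/
def sphereVolume [IsManifold (𝓡 n) ∞ M] (F : TangentBundle (𝓡 n) M → ℝ) :
    Measure (SphereBundle n M) :=
  ⨆ (e : IsManifold.maximalAtlas (𝓡 n) ∞ M) (k : Fin n) (ε : ℤˣ), localVolume F e k ε

/-! ### Energy and capacity -/

/-- `D` is a generalized differential of `u` that is locally `L^n`: in every chart, the components
of `D` are in `L^n` on compact sets and are the weak partial derivatives of `u`. -/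
def IsGenDifferential [IsManifold (𝓡 n) ∞ M] (u : M → ℝ)
    (D : ∀ x : M, TangentSpace (𝓡 n) x →L[ℝ] ℝ) : Prop :=
  ∀ e ∈ IsManifold.maximalAtlas (𝓡 n) ∞ M, ∀ i : Fin n,
    (∀ K : Set (Eu n), IsCompact K → K ⊆ e.target →
      MemLp (fun x => D (e.symm x) (chartInvDeriv e x (stdVec i))) (n : ENNReal)
        (volume.restrict K)) ∧
    ∀ ψ : Eu n → ℝ, ContDiff ℝ ∞ ψ → HasCompactSupport ψ → tsupport ψ ⊆ e.target →
      ∫ x in e.target, u (e.symm x) * fderiv ℝ ψ x (stdVec i) =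
        -∫ x in e.target, D (e.symm x) (chartInvDeriv e x (stdVec i)) * ψ x

variable [IsManifold (𝓡 n) ∞ M]

/-- The energy `I(u, M) = ∫_{SM} |∇ u^V|^n η`. A generalized differential of `u` is unique almost
everywhere, so the integral is the same for all of them, and the infimum is just this common value; it
is `∞` if `u` has no generalized differential. -/
def energy (F : FinslerStructure n M) (u : M → ℝ) : ENNReal :=
  ⨅ (D : ∀ x : M, TangentSpace (𝓡 n) x →L[ℝ] ℝ) (_ : IsGenDifferential u D),
    ∫⁻ s, ENNReal.ofReal (gradNorm F.toFun D s ^ n) ∂(sphereVolume F.toFun)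

/-- The space `H(M)` of continuous functions with a generalized differential and finite energy. -/
def spaceH (F : FinslerStructure n M) : Set (M → ℝ) :=
  {u | Continuous u ∧ (∃ D, IsGenDifferential (n := n) u D) ∧ energy F u < ⊤}

/-- The space `H₀(M)` of those `u ∈ H(M)` whose vertical lift has compact support in `SM`. -/
def spaceH₀ (F : FinslerStructure n M) : Set (M → ℝ) :=
  {u | u ∈ spaceH F ∧ HasCompactSupport (verticalLift (n := n) u)}

/-- The conformal capacity of `C`. -/
def capacity (F : FinslerStructure n M) (C : Set M) : ENNReal :=
  ⨅ (u : M → ℝ) (_ : u ∈ spaceH₀ F ∧ (∀ x ∈ C, u x = 1) ∧ ∀ x, 0 ≤ u x ∧ u x ≤ 1), energy F u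

/-- The capacity of the condenser `Γ(C₀, C₁, M)`; it is `∞` if there is no admissible function. -/
def condenserCapacity (F : FinslerStructure n M) (C₀ C₁ : Set M) : ENNReal :=
  ⨅ (u : M → ℝ) (_ : u ∈ spaceH F ∧ (∀ x ∈ C₀, u x = 0) ∧ (∀ x ∈ C₁, u x = 1) ∧
    ∀ x, 0 ≤ u x ∧ u x ≤ 1), energy F u

/-- A map between Finsler manifolds is conformal if its differential preserves angles: for every
nonzero `v ∈ T_xM`, the angle of `a, b ∈ T_xM` with respect to `g_v` equals the angle of `f_* a`
and `f_* b` with respect to `g'_{f_* v}`. -/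
def IsConformal {M' : Type*} [TopologicalSpace M'] [ChartedSpace (Eu n) M']
    [IsManifold (𝓡 n) ∞ M'] (F : FinslerStructure n M) (F' : FinslerStructure n M')
    (f : M → M') : Prop :=
  ∀ v : TangentBundle (𝓡 n) M, v.snd ≠ 0 → ∀ a b : TangentSpace (𝓡 n) v.proj, a ≠ 0 → b ≠ 0 →
    finslerAngle F'.toFun ⟨f v.proj, mfderiv (𝓡 n) (𝓡 n) f v.proj v.snd⟩
        (mfderiv (𝓡 n) (𝓡 n) f v.proj a) (mfderiv (𝓡 n) (𝓡 n) f v.proj b) =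
      finslerAngle F.toFun v a b

end Finsler

end

/-!
A conformal map `f` carries each inner product `g_v` to a multiple of `g'_{f_* v}`. By Knebelman's
argument (`exists_const_of_orthogonal`) the multiple does not depend on the direction `v`: Euler's
identity gives `d(F²) = 2 g_v(v, ·)` on a tangent space, so the quotient of `(F' ∘ f_*)²` by `F²` has
vanishing differential on the tangent space without the origin, which is connected as `n ≥ 2`. Hence
`F' ∘ f_* = ρ F` for a positive function `ρ` on `M` (`IsConformal.exists_factor`).

The energy density is then invariant. On the one hand, the gradient of a vertical lift is horizontal,
so its norm is the norm of the differential with respect to `g_v`, whatever the nonlinear connection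
is, and it is divided by `ρ` (`IsConformalFactor.gradNorm_map`). On the other hand, the Hilbert form is
`F_{y^i} dx^i`, so `ω' = ρ ω` and `dω' = ρ dω + dρ ∧ ω`; as `ω ∧ ω = 0`, the volume element
`ω ∧ (dω)^{n-1}` is multiplied by `ρ^n` (`wedgePow_add_wedge`, `IsConformalFactor.volCoeff_eq`).
Therefore `u ↦ u ∘ f⁻¹` does not increase the energy (`IsConformalFactor.energy_le`). It preserves all
admissibility conditions, and the same holds for `f⁻¹`, so both capacities agree.

Charts are transported by `e ↦ e ∘ f` (`pullChart`), which identifies the coordinate expressions on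
`M` with those on `M'`, and tangent vectors are transported by `tangentMap`.
-/

noncomputable section

/-! ### Minkowski norms and Knebelman's theorem -/

section Minkowski

variable {E E' : Type*} [NormedAddCommGroup E] [NormedSpace ℝ E]
  [NormedAddCommGroup E'] [NormedSpace ℝ E']

/-- The form `g_v(a, b) = (1/2) ∂_b ∂_a (G²)` at `v` of a function `G` on a normed space: the
counterpart of `fundForm` on a single vector space. By definition, `fundForm F v` is this form for
`G = F` restricted to the tangent space of `v`. -/
def halfHess (G : E → ℝ) (v a b : E) : ℝ :=
  (1 / 2) * fderiv ℝ (fun y => fderiv ℝ (fun w => G w ^ 2) y a) v b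

/-- `G` is a Minkowski norm: the restriction of a Finsler function to a tangent space. It is not
assumed to be reversible, and its value at `0` is irrelevant. -/
structure IsMinkowski (G : E → ℝ) : Prop where
  nonneg : ∀ y, y ≠ 0 → 0 ≤ G y
  smooth : ContDiffOn ℝ ∞ G {0}ᶜ
  homogeneous : ∀ y, y ≠ 0 → ∀ t : ℝ, 0 < t → G (t • y) = t * G y
  posDef : ∀ v, v ≠ 0 → ∀ a, a ≠ 0 → 0 < halfHess G v a a

namespace IsMinkowski

variable {G : E → ℝ} (hG : IsMinkowski G)
include hG

theorem contDiffAt {v : E} (hv : v ≠ 0) : ContDiffAt ℝ ∞ G v :=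
  hG.smooth.contDiffAt (isOpen_compl_singleton.mem_nhds hv)

theorem contDiffAt_sq {v : E} (hv : v ≠ 0) : ContDiffAt ℝ ∞ (fun w => G w ^ 2) v :=
  (hG.contDiffAt hv).pow 2

theorem differentiableAt_fderiv_sq {v : E} (hv : v ≠ 0) :
    DifferentiableAt ℝ (fderiv ℝ (fun w => G w ^ 2)) v :=
  ((hG.contDiffAt_sq hv).fderiv_right (m := 1)
    (by norm_num; exact WithTop.coe_le_coe.2 le_top)).differentiableAt
    (by simp)

theorem halfHess_eq {v : E} (hv : v ≠ 0) (a b : E) :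
    halfHess G v a b = (1 / 2) * fderiv ℝ (fderiv ℝ (fun w => G w ^ 2)) v b a := by
  rw [halfHess, fderiv_clm_apply (hG.differentiableAt_fderiv_sq hv) (by fun_prop)]
  simp

theorem halfHess_symm {v : E} (hv : v ≠ 0) (a b : E) : halfHess G v a b = halfHess G v b a := by
  rw [hG.halfHess_eq hv, hG.halfHess_eq hv]
  have := ((hG.contDiffAt_sq hv).isSymmSndFDerivAt (by
    simpa using (WithTop.coe_le_coe.2 le_top : ((2 : ℕ∞) : WithTop ℕ∞) ≤ ∞))).eq a b
  rw [this]

theorem halfHess_add_left {v : E} (hv : v ≠ 0) (a a' b : E) :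
    halfHess G v (a + a') b = halfHess G v a b + halfHess G v a' b := by
  simp only [hG.halfHess_eq hv, map_add]; ring

theorem halfHess_smul_left {v : E} (hv : v ≠ 0) (c : ℝ) (a b : E) :
    halfHess G v (c • a) b = c * halfHess G v a b := by
  simp only [hG.halfHess_eq hv, map_smul, smul_eq_mul]; ring

theorem halfHess_add_right {v : E} (hv : v ≠ 0) (a b b' : E) :
    halfHess G v a (b + b') = halfHess G v a b + halfHess G v a b' := by
  simp only [hG.halfHess_symm hv a, hG.halfHess_add_left hv]

theorem halfHess_smul_right {v : E} (hv : v ≠ 0) (c : ℝ) (a b : E) :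
    halfHess G v a (c • b) = c * halfHess G v a b := by
  simp only [hG.halfHess_symm hv a, hG.halfHess_smul_left hv]

theorem eventually_homogeneous {v : E} (hv : v ≠ 0) {t : ℝ} (ht : 0 < t) :
    (fun w => G (t • w) ^ 2) =ᶠ[nhds v] fun w => t ^ 2 * G w ^ 2 := by
  filter_upwards [isOpen_compl_singleton.mem_nhds hv] with w hw
  rw [hG.homogeneous w hw t ht]; ring

theorem fderiv_sq_smul {v : E} (hv : v ≠ 0) {t : ℝ} (ht : 0 < t) :
    fderiv ℝ (fun w => G w ^ 2) (t • v) = t • fderiv ℝ (fun w => G w ^ 2) v := by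
  have h1 := (hG.eventually_homogeneous hv ht).fderiv_eq (𝕜 := ℝ)
  have h2 : fderiv ℝ (fun w => G (t • w) ^ 2) v = t • fderiv ℝ (fun w => G w ^ 2) (t • v) :=
    fderiv_comp_smul (f := fun w => G w ^ 2) t
  rw [h2, fderiv_const_mul ((hG.contDiffAt_sq hv).differentiableAt (by simp)), pow_two,
    mul_smul] at h1
  exact smul_right_injective (E →L[ℝ] ℝ) ht.ne' h1

/-- `g_v` depends on the ray of `v` only. -/
theorem halfHess_smul {v : E} (hv : v ≠ 0) {t : ℝ} (ht : 0 < t) (a b : E) :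
    halfHess G (t • v) a b = halfHess G v a b := by
  have htv : t • v ≠ 0 := smul_ne_zero ht.ne' hv
  rw [hG.halfHess_eq hv, hG.halfHess_eq htv]
  have h1 : (fun w => fderiv ℝ (fun w => G w ^ 2) (t • w)) =ᶠ[nhds v]
      fun w => t • fderiv ℝ (fun w => G w ^ 2) w := by
    filter_upwards [isOpen_compl_singleton.mem_nhds hv] with w hw
    exact hG.fderiv_sq_smul hw ht
  have h2 := h1.fderiv_eq (𝕜 := ℝ)
  rw [fderiv_comp_smul (f := fderiv ℝ (fun w => G w ^ 2)) t,
    fderiv_fun_const_smul (hG.differentiableAt_fderiv_sq hv)] at h2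
  rw [smul_right_injective (E →L[ℝ] E →L[ℝ] ℝ) ht.ne' h2]

theorem fderiv_sq_apply_self {v : E} (hv : v ≠ 0) :
    fderiv ℝ (fun w => G w ^ 2) v v = 2 * G v ^ 2 := by
  have h1 : HasDerivAt (fun t : ℝ => G (t • v) ^ 2) (fderiv ℝ (fun w => G w ^ 2) v v) 1 := by
    have h := ((hG.contDiffAt_sq hv).differentiableAt (by simp)).hasFDerivAt
    have hl : HasDerivAt (fun t : ℝ => t • v) v 1 := by
      simpa using (hasDerivAt_id (1 : ℝ)).smul_const v
    rw [← one_smul ℝ v] at h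
    simpa [Function.comp_def] using h.comp_hasDerivAt (1 : ℝ) hl
  have h2 : HasDerivAt (fun t : ℝ => G (t • v) ^ 2) (2 * G v ^ 2) 1 := by
    have h3 : HasDerivAt (fun t : ℝ => t ^ 2 * G v ^ 2) (2 * G v ^ 2) 1 := by
      simpa using (hasDerivAt_pow 2 (1 : ℝ)).mul_const (G v ^ 2)
    refine h3.congr_of_eventuallyEq ?_
    filter_upwards [lt_mem_nhds (one_pos : (0 : ℝ) < 1)] with t ht
    rw [hG.homogeneous v hv t ht]; ring
  exact h1.unique h2

/-- Euler's identity for the derivative of `G²`, which is homogeneous of degree one. -/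
theorem halfHess_self_left {v : E} (hv : v ≠ 0) (b : E) :
    halfHess G v v b = (1 / 2) * fderiv ℝ (fun w => G w ^ 2) v b := by
  rw [hG.halfHess_symm hv, halfHess]
  congr 1
  have h1 : HasDerivAt (fun t : ℝ => fderiv ℝ (fun w => G w ^ 2) (t • v) b)
      (fderiv ℝ (fun y => fderiv ℝ (fun w => G w ^ 2) y b) v v) 1 := by
    have h := ((hG.differentiableAt_fderiv_sq hv).clm_apply
      (differentiableAt_const b)).hasFDerivAt
    have hl : HasDerivAt (fun t : ℝ => t • v) v 1 := by
      simpa using (hasDerivAt_id (1 : ℝ)).smul_const v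
    rw [← one_smul ℝ v] at h
    simpa [Function.comp_def] using h.comp_hasDerivAt (1 : ℝ) hl
  have h2 : HasDerivAt (fun t : ℝ => fderiv ℝ (fun w => G w ^ 2) (t • v) b)
      (fderiv ℝ (fun w => G w ^ 2) v b) 1 := by
    have h3 : HasDerivAt (fun t : ℝ => t * fderiv ℝ (fun w => G w ^ 2) v b)
        (fderiv ℝ (fun w => G w ^ 2) v b) 1 := by
      simpa using (hasDerivAt_id (1 : ℝ)).mul_const (fderiv ℝ (fun w => G w ^ 2) v b)
    refine h3.congr_of_eventuallyEq ?_
    filter_upwards [lt_mem_nhds (one_pos : (0 : ℝ) < 1)] with t ht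
    rw [hG.fderiv_sq_smul hv ht]; rfl
  exact h1.unique h2

theorem halfHess_self {v : E} (hv : v ≠ 0) : halfHess G v v v = G v ^ 2 := by
  rw [hG.halfHess_self_left hv, hG.fderiv_sq_apply_self hv]; ring

theorem pos {v : E} (hv : v ≠ 0) : 0 < G v := by
  refine (hG.nonneg v hv).lt_of_ne fun h => ?_
  have := hG.posDef v hv v hv
  rw [hG.halfHess_self hv, ← h] at this
  simp at this

theorem halfHess_self_left' {v : E} (hv : v ≠ 0) (b : E) :
    halfHess G v v b = G v * fderiv ℝ G v b := by
  rw [hG.halfHess_self_left hv,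
    fderiv_fun_pow 2 ((hG.contDiffAt hv).differentiableAt (by simp))]
  simp; ring

theorem halfHess_inv_smul_self {v : E} (hv : v ≠ 0) (b : E) :
    halfHess G v ((G v)⁻¹ • v) b = fderiv ℝ G v b := by
  rw [hG.halfHess_smul_left hv, hG.halfHess_self_left' hv, inv_mul_cancel_left₀ (hG.pos hv).ne']

end IsMinkowski

/-- If `G' ∘ L` is a multiple of `G`, the corresponding forms are proportional. -/
theorem halfHess_map {G : E → ℝ} {G' : E' → ℝ} (hG : IsMinkowski G) (hG' : IsMinkowski G')
    (L : E →L[ℝ] E') (hL : ∀ y, y ≠ 0 → L y ≠ 0) (c : ℝ)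
    (h : ∀ y, y ≠ 0 → G' (L y) = c * G y) {v : E} (hv : v ≠ 0) (a b : E) :
    halfHess G' (L v) (L a) (L b) = c ^ 2 * halfHess G v a b := by
  have h1 : ∀ w, w ≠ 0 → fderiv ℝ (fun w => G' w ^ 2) (L w) (L a) =
      c ^ 2 * fderiv ℝ (fun w => G w ^ 2) w a := fun w hw => by
    have e1 : (fun w => G' (L w) ^ 2) =ᶠ[nhds w] fun w => c ^ 2 * G w ^ 2 := by
      filter_upwards [isOpen_compl_singleton.mem_nhds hw] with w hw
      rw [h w hw]; ring
    have e2 := e1.fderiv_eq (𝕜 := ℝ)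
    rw [fderiv_const_mul ((hG.contDiffAt_sq hw).differentiableAt (by simp))] at e2
    have e3 := ((hG'.contDiffAt_sq (hL w hw)).differentiableAt (by simp)).hasFDerivAt.comp w
      L.hasFDerivAt
    have e4 := e3.fderiv
    have := congrArg (fun T : E →L[ℝ] ℝ => T a) (e4.symm.trans e2)
    simpa using this
  have e1 : (fun w => fderiv ℝ (fun w => G' w ^ 2) (L w) (L a)) =ᶠ[nhds v]
      fun w => c ^ 2 * fderiv ℝ (fun w => G w ^ 2) w a := by
    filter_upwards [isOpen_compl_singleton.mem_nhds hv] with w hw using h1 w hw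
  have d1 : DifferentiableAt ℝ (fun w => fderiv ℝ (fun w => G w ^ 2) w a) v :=
    (hG.differentiableAt_fderiv_sq hv).clm_apply (differentiableAt_const a)
  have d2 : DifferentiableAt ℝ (fun w => fderiv ℝ (fun w => G' w ^ 2) w (L a)) (L v) :=
    (hG'.differentiableAt_fderiv_sq (hL v hv)).clm_apply (differentiableAt_const (L a))
  have e2 := e1.fderiv_eq (𝕜 := ℝ)
  rw [fderiv_const_mul d1] at e2
  have e4 := (d2.hasFDerivAt.comp v L.hasFDerivAt).fderiv
  have := congrArg (fun T : E →L[ℝ] ℝ => T b) (e4.symm.trans e2)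
  simp only [ContinuousLinearMap.comp_apply, smul_eq_mul, smul_apply] at this
  rw [halfHess, halfHess, this]; ring

/-- If `g_v`-orthogonal vectors are `L^* g'_{Lv}`-orthogonal, then `L^* g'_{Lv}(v, ·)` is a multiple
of `g_v(v, ·)`. The full proportionality of the two forms is not needed. -/
theorem halfHess_map_self_left_of_orthogonal {G : E → ℝ} {G' : E' → ℝ} (hG : IsMinkowski G)
    (hG' : IsMinkowski G') (L : E →L[ℝ] E') (hL : ∀ y, y ≠ 0 → L y ≠ 0) {v : E} (hv : v ≠ 0)
    (h : ∀ a b, a ≠ 0 → b ≠ 0 → halfHess G v a b = 0 → halfHess G' (L v) (L a) (L b) = 0) :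
    ∀ b, halfHess G' (L v) (L v) (L b) =
      (halfHess G' (L v) (L v) (L v) / halfHess G v v v) * halfHess G v v b := by
  intro b
  have hLv := hL v hv
  have hp := hG.posDef v hv v hv
  set c := halfHess G v v b / halfHess G v v v with hc
  have hb : b = c • v + (b - c • v) := by abel
  have hz : halfHess G v v (b - c • v) = 0 := by
    have := hG.halfHess_add_right hv v (c • v) (b - c • v)
    rw [← hb, hG.halfHess_smul_right hv, hc, div_mul_cancel₀ _ hp.ne'] at this
    linarith
  have hz' : halfHess G' (L v) (L v) (L (b - c • v)) = 0 := by
    by_cases h0 : b - c • v = 0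
    · rw [h0, map_zero, ← zero_smul ℝ (0 : E'), hG'.halfHess_smul_right hLv, zero_mul]
    · exact h v _ hv h0 hz
  calc halfHess G' (L v) (L v) (L b)
      = halfHess G' (L v) (L v) (c • L v + L (b - c • v)) := by
        rw [← map_smul, ← map_add, ← hb]
    _ = c * halfHess G' (L v) (L v) (L v) := by
        rw [hG'.halfHess_add_right hLv, hG'.halfHess_smul_right hLv, hz', add_zero]
    _ = _ := by rw [hc]; ring

/-- Knebelman's theorem on one tangent space: if `g_v`-orthogonal vectors are
`L^* g'_{Lv}`-orthogonal for every `v`, then the conformal factor does not depend on `v`, so `G' ∘ L`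
is a constant multiple of `G`. -/
theorem exists_const_of_orthogonal (hE : 1 < Module.rank ℝ E) {G : E → ℝ} {G' : E' → ℝ}
    (hG : IsMinkowski G) (hG' : IsMinkowski G') (L : E →L[ℝ] E') (hL : ∀ y, y ≠ 0 → L y ≠ 0)
    (h : ∀ v, v ≠ 0 → ∀ a b, a ≠ 0 → b ≠ 0 → halfHess G v a b = 0 →
      halfHess G' (L v) (L a) (L b) = 0) :
    ∃ c : ℝ, 0 < c ∧ ∀ y, y ≠ 0 → G' (L y) = c * G y := by
  -- By Euler's identity `d(G²)` is `2 g_v(v, ·)`, so the differentials of `(G' ∘ L)²` and `G²` are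
  -- in the ratio of the functions themselves; the quotient is constant as `E ∖ 0` is connected.
  have hd : ∀ v ∈ ({0}ᶜ : Set E), HasFDerivAt (fun y => G' (L y) ^ 2 / G y ^ 2)
      (0 : E →L[ℝ] ℝ) v := by
    intro v hv
    have hv : v ≠ 0 := hv
    have hGv := hG.pos hv
    have d1 : HasFDerivAt (fun y => G' (L y) ^ 2) _ v :=
      ((hG'.contDiffAt_sq (hL v hv)).differentiableAt (by simp)).hasFDerivAt.comp v
        L.hasFDerivAt
    have d2 := ((hG.contDiffAt_sq hv).differentiableAt (by simp)).hasFDerivAt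
    have d3 : HasFDerivAt (fun y => G' (L y) ^ 2 / G y ^ 2) _ v :=
      d1.mul ((hasDerivAt_inv (pow_ne_zero 2 hGv.ne')).comp_hasFDerivAt v d2)
    refine d3.congr_fderiv ?_
    ext b
    have hp := halfHess_map_self_left_of_orthogonal hG hG' L hL hv (h v hv) b
    rw [hG.halfHess_self hv, hG'.halfHess_self (hL v hv), hG.halfHess_self_left hv,
      hG'.halfHess_self_left (hL v hv)] at hp
    simp only [zero_apply, smul_apply,
      add_apply, ContinuousLinearMap.comp_apply, smul_eq_mul]
    field_simp at hp
    field_simp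
    linarith
  have hconn := (isConnected_compl_singleton_of_one_lt_rank hE (0 : E)).isPreconnected
  obtain ⟨y₀, hy₀⟩ := (isConnected_compl_singleton_of_one_lt_rank hE (0 : E)).nonempty
  have hy₀ : y₀ ≠ 0 := hy₀
  have hconst : ∀ y, y ≠ 0 → G' (L y) ^ 2 / G y ^ 2 = G' (L y₀) ^ 2 / G y₀ ^ 2 := fun y hy =>
    isOpen_compl_singleton.is_const_of_fderiv_eq_zero hconn
      (fun v hv => (hd v hv).differentiableAt.differentiableWithinAt)
      (fun v hv => (hd v hv).fderiv) hy hy₀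
  refine ⟨G' (L y₀) / G y₀, div_pos (hG'.pos (hL _ hy₀)) (hG.pos hy₀), fun y hy => ?_⟩
  have h1 := hconst y hy
  rw [← div_pow, ← div_pow] at h1
  have h2 := (sq_eq_sq₀ (div_pos (hG'.pos (hL _ hy)) (hG.pos hy)).le
    (div_pos (hG'.pos (hL _ hy₀)) (hG.pos hy₀)).le).1 h1
  rw [← h2, div_mul_cancel₀ _ (hG.pos hy).ne']

/-- The form `g_v` is nondegenerate: its Gram matrix on the images of the standard vectors under
an injective linear map is invertible. -/
theorem IsMinkowski.isUnit_det {n : ℕ} {G : E → ℝ} (hG : IsMinkowski G) (A : Eu n →L[ℝ] E)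
    (hA : ∀ y, y ≠ 0 → A y ≠ 0) {v : E} (hv : v ≠ 0) :
    IsUnit (Matrix.of fun i j : Fin n => halfHess G v (A (stdVec i)) (A (stdVec j))).det := by
  rw [isUnit_iff_ne_zero, Ne, ← Matrix.exists_mulVec_eq_zero_iff]
  rintro ⟨c, hc, h⟩
  let a : Eu n := WithLp.toLp 2 c
  have ha : a = ∑ j, c j • stdVec j := by
    ext i; simp [a, Pi.single_apply]
  have ha0 : a ≠ 0 := fun h0 => hc (by ext i; simpa [a] using congrArg (fun z : Eu n => z i) h0)
  have hzero : ∀ i, halfHess G v (A (stdVec i)) (A a) = 0 := by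
    intro i
    have h1 := congrFun h i
    simp only [Matrix.mulVec, dotProduct, Pi.zero_apply, Matrix.of_apply] at h1
    rw [← h1, hG.halfHess_eq hv, ha]
    simp only [map_sum, map_smul, sum_apply, smul_apply, hG.halfHess_eq hv, Finset.mul_sum,
      smul_eq_mul]
    exact Finset.sum_congr rfl fun j _ => by ring
  refine (hG.posDef _ hv (A a) (hA a ha0)).ne' ?_
  have h2 : halfHess G v (A a) (A a) = ∑ i, c i * halfHess G v (A (stdVec i)) (A a) := by
    simp only [hG.halfHess_eq hv]
    rw [show fderiv ℝ (fderiv ℝ fun w => G w ^ 2) v (A a) (A a) =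
      fderiv ℝ (fderiv ℝ fun w => G w ^ 2) v (A a) (A (∑ j, c j • stdVec j)) by rw [← ha]]
    simp only [map_sum, map_smul, smul_eq_mul, Finset.mul_sum]
    exact Finset.sum_congr rfl fun j _ => by ring
  rw [h2]
  simp [hzero]

theorem IsMinkowski.halfHess_sum {n : ℕ} {G : E → ℝ} (hG : IsMinkowski G) (A : Eu n →L[ℝ] E)
    {v : E} (hv : v ≠ 0) (a b : Eu n) :
    halfHess G v (A a) (A b) =
      ∑ i, ∑ j, halfHess G v (A (stdVec i)) (A (stdVec j)) * a i * b j := by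
  have hs : ∀ a : Eu n, a = ∑ j, a j • stdVec j := fun a => by
    ext i; simp [Pi.single_apply]
  conv_lhs => rw [hs a, hs b]
  simp only [hG.halfHess_eq hv, map_sum, map_smul, sum_apply, smul_apply, smul_eq_mul,
    Finset.mul_sum]
  exact Finset.sum_congr rfl fun i _ => Finset.sum_congr rfl fun j _ => by ring

end Minkowski

/-! ### The wedge product `α ∧ β^m` -/

section Wedge

variable {V : Type*} [NormedAddCommGroup V] [NormedSpace ℝ V]

theorem extDeriv_apply_pair {θ : V → V [⋀^Fin 1]→L[ℝ] ℝ} {x : V} (h : DifferentiableAt ℝ θ x)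
    (a b : V) : extDeriv θ x ![a, b] =
      fderiv ℝ (fun x => θ x ![b]) x a - fderiv ℝ (fun x => θ x ![a]) x b := by
  have e0 : Fin.removeNth 0 ![a, b] = ![b] := by ext i; fin_cases i; rfl
  have e1 : Fin.removeNth 1 ![a, b] = ![a] := by ext i; fin_cases i; rfl
  rw [extDeriv_apply h, Fin.sum_univ_two, e0, e1]
  simp [sub_eq_add_neg]

theorem wedgePow_smul (m : ℕ) (c : ℝ)
    (α : V [⋀^Fin 1]→L[ℝ] ℝ) (β : V [⋀^Fin 2]→L[ℝ] ℝ) (v : Fin (2 * m + 1) → V) :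
    wedgePow m (c • α) β v = c * wedgePow m α β v := by
  simp only [wedgePow, ContinuousAlternatingMap.smul_apply, smul_eq_mul, Finset.mul_sum]
  exact Finset.sum_congr rfl fun σ _ => by ring

/-- A sum over permutations with signs vanishes if the summand is invariant under a
transposition. -/
theorem sum_sign_mul_eq_zero {N : ℕ} (i j : Fin N) (hij : i ≠ j)
    (T : Equiv.Perm (Fin N) → ℝ) (hT : ∀ σ, T (σ * Equiv.swap i j) = T σ) :
    ∑ σ : Equiv.Perm (Fin N), ((Equiv.Perm.sign σ : ℤ) : ℝ) * T σ = 0 := by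
  have h := Equiv.sum_comp (Equiv.mulRight (Equiv.swap i j))
    (fun σ : Equiv.Perm (Fin N) => ((Equiv.Perm.sign σ : ℤ) : ℝ) * T σ)
  simp only [Equiv.coe_mulRight, hT, Equiv.Perm.sign_mul, Equiv.Perm.sign_swap hij] at h
  simp only [mul_neg, mul_one, Units.val_neg, Int.cast_neg, neg_mul, Finset.sum_neg_distrib] at h
  linarith

/-- `α ∧ (c β + γ ∧ α)^m = c^m α ∧ β^m`: every other term of the expansion contains `α ∧ α`. -/
theorem wedgePow_add_wedge (m : ℕ) (α : V [⋀^Fin 1]→L[ℝ] ℝ) (β β' : V [⋀^Fin 2]→L[ℝ] ℝ)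
    (γ : V → ℝ) (c : ℝ)
    (hβ : ∀ a b, β' ![a, b] = c * β ![a, b] + (γ a * α ![b] - γ b * α ![a]))
    (v : Fin (2 * m + 1) → V) :
    wedgePow m α β' v = c ^ m * wedgePow m α β v := by
  have key : ∀ S : Finset (Fin m), S ≠ Finset.univ →
      ∑ σ : Equiv.Perm (Fin (2 * m + 1)), ((Equiv.Perm.sign σ : ℤ) : ℝ) * (α ![v (σ 0)] *
        ((∏ i ∈ S, c * β ![v (σ ⟨2 * i.1 + 1, by omega⟩), v (σ ⟨2 * i.1 + 2, by omega⟩)]) *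
        ∏ i ∈ Finset.univ \ S,
          (γ (v (σ ⟨2 * i.1 + 1, by omega⟩)) * α ![v (σ ⟨2 * i.1 + 2, by omega⟩)] -
            γ (v (σ ⟨2 * i.1 + 2, by omega⟩)) * α ![v (σ ⟨2 * i.1 + 1, by omega⟩)]))) = 0 := by
    intro S hS
    obtain ⟨k, hk⟩ : ∃ k, k ∉ S := by
      by_contra! h
      exact hS (Finset.eq_univ_iff_forall.2 h)
    have hk' : k ∈ Finset.univ \ S := by simp [hk]
    -- the factors with index different from `k` do not see the positions `0, 2k+1, 2k+2`
    have hsw : ∀ (p : Fin (2 * m + 1)) (σ : Equiv.Perm (Fin (2 * m + 1))) (i : Fin m),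
        (p.1 = 2 * k.1 + 1 ∨ p.1 = 2 * k.1 + 2) → i ≠ k →
        (σ * Equiv.swap 0 p) ⟨2 * i.1 + 1, by omega⟩ = σ ⟨2 * i.1 + 1, by omega⟩ ∧
        (σ * Equiv.swap 0 p) ⟨2 * i.1 + 2, by omega⟩ = σ ⟨2 * i.1 + 2, by omega⟩ := by
      intro p σ i hp hi
      have hi' : i.1 ≠ k.1 := fun h => hi (Fin.ext h)
      simp only [Equiv.Perm.mul_apply]
      constructor <;>
      · rw [Equiv.swap_apply_of_ne_of_ne]
        · simp [Fin.ext_iff]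
        · intro h
          have := congrArg Fin.val h
          simp only at this
          omega
    have hne : ∀ q : ℕ, ∀ hq : q + 1 < 2 * m + 1, (0 : Fin (2 * m + 1)) ≠ ⟨q + 1, hq⟩ := by
      intro q hq h
      simpa using congrArg Fin.val h
    let R : Equiv.Perm (Fin (2 * m + 1)) → ℝ := fun σ =>
      (∏ i ∈ S, c * β ![v (σ ⟨2 * i.1 + 1, by omega⟩), v (σ ⟨2 * i.1 + 2, by omega⟩)]) *
        ∏ i ∈ (Finset.univ \ S).erase k,
          (γ (v (σ ⟨2 * i.1 + 1, by omega⟩)) * α ![v (σ ⟨2 * i.1 + 2, by omega⟩)] -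
            γ (v (σ ⟨2 * i.1 + 2, by omega⟩)) * α ![v (σ ⟨2 * i.1 + 1, by omega⟩)])
    have hR : ∀ (p : Fin (2 * m + 1)) (σ : Equiv.Perm (Fin (2 * m + 1))),
        (p.1 = 2 * k.1 + 1 ∨ p.1 = 2 * k.1 + 2) → R (σ * Equiv.swap 0 p) = R σ := by
      intro p σ hp
      simp only [R]
      congr 1
      · refine Finset.prod_congr rfl fun i hi => ?_
        have := hsw p σ i hp (fun h => hk (h ▸ hi))
        rw [this.1, this.2]
      · refine Finset.prod_congr rfl fun i hi => ?_
        have := hsw p σ i hp (Finset.ne_of_mem_erase hi)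
        rw [this.1, this.2]
    -- both summands of the factor `γ ∧ α` with index `k` give a product symmetric in the positions
    -- `0` and `2k+2`, respectively `0` and `2k+1`
    have h1 := sum_sign_mul_eq_zero 0 ⟨2 * k.1 + 2, by omega⟩ (hne _ _)
      (fun σ => α ![v (σ 0)] * α ![v (σ ⟨2 * k.1 + 2, by omega⟩)] *
        γ (v (σ ⟨2 * k.1 + 1, by omega⟩)) * R σ) (by
          intro σ
          have h3 : Equiv.swap 0 (⟨2 * k.1 + 2, by omega⟩ : Fin (2 * m + 1))
              ⟨2 * k.1 + 1, by omega⟩ = ⟨2 * k.1 + 1, by omega⟩ := by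
            rw [Equiv.swap_apply_of_ne_of_ne (hne _ _).symm]
            simp [Fin.ext_iff]
          simp only [hR ⟨2 * k.1 + 2, by omega⟩ σ (Or.inr rfl)]
          simp only [Equiv.Perm.mul_apply, Equiv.swap_apply_left, Equiv.swap_apply_right, h3]
          ring)
    have h2 := sum_sign_mul_eq_zero 0 ⟨2 * k.1 + 1, by omega⟩ (hne _ _)
      (fun σ => α ![v (σ 0)] * α ![v (σ ⟨2 * k.1 + 1, by omega⟩)] *
        γ (v (σ ⟨2 * k.1 + 2, by omega⟩)) * R σ) (by
          intro σ
          have h3 : Equiv.swap 0 (⟨2 * k.1 + 1, by omega⟩ : Fin (2 * m + 1))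
              ⟨2 * k.1 + 2, by omega⟩ = ⟨2 * k.1 + 2, by omega⟩ := by
            rw [Equiv.swap_apply_of_ne_of_ne (hne _ _).symm]
            simp [Fin.ext_iff]
          simp only [hR ⟨2 * k.1 + 1, by omega⟩ σ (Or.inl rfl)]
          simp only [Equiv.Perm.mul_apply, Equiv.swap_apply_left, Equiv.swap_apply_right, h3]
          ring)
    rw [← sub_zero (0 : ℝ)]
    nth_rewrite 1 [← h1]
    nth_rewrite 1 [← h2]
    rw [← Finset.sum_sub_distrib]
    refine Finset.sum_congr rfl fun σ _ => ?_
    rw [← Finset.mul_prod_erase _ _ hk']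
    simp only [R]
    ring
  rw [wedgePow, wedgePow, mul_left_comm]
  congr 1
  simp only [hβ, Finset.prod_add, Finset.powerset_univ, Finset.mul_sum]
  rw [Finset.sum_comm, Finset.sum_eq_single Finset.univ]
  · refine Finset.sum_congr rfl fun σ _ => ?_
    simp only [Finset.sdiff_self, Finset.prod_empty, Finset.prod_mul_distrib, Finset.prod_const,
      Finset.card_univ, Fintype.card_fin]
    ring
  · intro S _ hS
    rw [← key S hS]
    exact Finset.sum_congr rfl fun σ _ => by ring
  · simp

end Wedge

/-! ### Finsler functions in induced coordinates and the gradient of a vertical lift -/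

section Coordinates

variable {n : ℕ} {M : Type*} [TopologicalSpace M] [ChartedSpace (Eu n) M]

theorem mdifferentiable_of_mem_maximalAtlas {e : OpenPartialHomeomorph M (Eu n)}
    (he : e ∈ IsManifold.maximalAtlas (𝓡 n) ∞ M) : e.MDifferentiable (𝓡 n) (𝓡 n) :=
  ⟨(contMDiffOn_of_mem_maximalAtlas he).mdifferentiableOn (by simp),
    (contMDiffOn_symm_of_mem_maximalAtlas he).mdifferentiableOn (by simp)⟩

theorem chartInvDeriv_surjective {e : OpenPartialHomeomorph M (Eu n)}
    (he : e ∈ IsManifold.maximalAtlas (𝓡 n) ∞ M) {x : Eu n} (hx : x ∈ e.target) :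
    Function.Surjective (chartInvDeriv e x) :=
  (mdifferentiable_of_mem_maximalAtlas he).symm.mfderiv_surjective hx

theorem tangentOfCoord_coordOfTangent {e : OpenPartialHomeomorph M (Eu n)}
    (he : e ∈ IsManifold.maximalAtlas (𝓡 n) ∞ M) (v : TangentBundle (𝓡 n) M)
    (hv : v.proj ∈ e.source) : tangentOfCoord e (coordOfTangent e v) = v := by
  have hd := mdifferentiable_of_mem_maximalAtlas he
  have h1 := hd.symm_comp_deriv hv
  refine Bundle.TotalSpace.ext (e.left_inv hv) ?_
  refine heq_of_eq ?_
  exact congrArg (fun T : Eu n →L[ℝ] Eu n => T v.snd) h1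

variable [IsManifold (𝓡 n) ∞ M]

theorem contMDiff_mk_tangentBundle_model :
    ContMDiff 𝓘(ℝ, Eu n × Eu n) (𝓡 n).tangent ∞
      (fun p : Eu n × Eu n => (⟨p.1, p.2⟩ : TangentBundle (𝓡 n) (Eu n))) := by
  intro p
  rw [Bundle.contMDiffAt_totalSpace]
  refine ⟨contDiff_fst.contMDiff.contMDiffAt, ?_⟩
  simpa using (contDiff_snd (E := Eu n) (F := Eu n)).contMDiff.contMDiffAt (x := p)

theorem contMDiffOn_tangentMap_symm {e : OpenPartialHomeomorph M (Eu n)}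
    (he : e ∈ IsManifold.maximalAtlas (𝓡 n) ∞ M) :
    ContMDiffOn (𝓡 n).tangent (𝓡 n).tangent ∞ (tangentMap (𝓡 n) (𝓡 n) e.symm)
      (Bundle.TotalSpace.proj ⁻¹' e.target) := by
  have h1 := (contMDiffOn_symm_of_mem_maximalAtlas he).contMDiffOn_tangentMapWithin
    (m := ∞) (by simp) e.open_target.uniqueMDiffOn
  refine h1.congr fun p hp => ?_
  exact (tangentMapWithin_eq_tangentMap
    (e.open_target.uniqueMDiffOn p.1 hp)
    ((mdifferentiable_of_mem_maximalAtlas he).mdifferentiableAt_symm hp)).symm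

theorem contMDiffOn_tangentOfCoord {e : OpenPartialHomeomorph M (Eu n)}
    (he : e ∈ IsManifold.maximalAtlas (𝓡 n) ∞ M) :
    ContMDiffOn 𝓘(ℝ, Eu n × Eu n) (𝓡 n).tangent ∞ (tangentOfCoord e)
      (e.target ×ˢ Set.univ) := by
  have h := contMDiff_mk_tangentBundle_model (n := n)
  exact (contMDiffOn_tangentMap_symm he).comp (t := Bundle.TotalSpace.proj ⁻¹' e.target)
    (s := e.target ×ˢ Set.univ) h.contMDiffOn (fun p hp => hp.1)

variable (F : FinslerStructure n M)

/-- In induced coordinates, the Finsler function is smooth off the zero section. -/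
theorem FinslerStructure.contDiffOn_coord {e : OpenPartialHomeomorph M (Eu n)}
    (he : e ∈ IsManifold.maximalAtlas (𝓡 n) ∞ M) :
    ContDiffOn ℝ ∞ (fun p => F.toFun (tangentOfCoord e p)) (e.target ×ˢ {0}ᶜ) := by
  rw [← contMDiffOn_iff_contDiffOn]
  refine F.smooth.comp ((contMDiffOn_tangentOfCoord he).mono
    (Set.prod_mono subset_rfl (Set.subset_univ _))) ?_
  rintro ⟨x, y⟩ ⟨hx, hy⟩
  exact chartInvDeriv_ne_zero he hx hy

/-- The restriction of a Finsler function to a tangent space is a Minkowski norm. -/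
theorem FinslerStructure.isMinkowski (x : M) :
    IsMinkowski (E := Eu n) (fun w => F.toFun ⟨x, w⟩) where
  nonneg y hy := F.nonneg ⟨x, y⟩ hy
  smooth := by
    have he : chartAt (Eu n) x ∈ IsManifold.maximalAtlas (𝓡 n) ∞ M :=
      IsManifold.chart_mem_maximalAtlas x
    have hd := mdifferentiable_of_mem_maximalAtlas he
    have hx := mem_chart_source (Eu n) x
    let A : Eu n →L[ℝ] Eu n := mfderiv (𝓡 n) (𝓡 n) (chartAt (Eu n) x) x
    have hA : ∀ w : Eu n, w ≠ 0 → A w ≠ 0 := fun w hw h =>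
      hw (hd.mfderiv_injective hx (h.trans (map_zero _).symm))
    have h := (F.contDiffOn_coord he).comp (s := {0}ᶜ) (f := fun w => (chartAt (Eu n) x x, A w))
      (by fun_prop) (fun w hw => ⟨(chartAt (Eu n) x).map_source hx, hA w hw⟩)
    refine h.congr fun w _ => ?_
    exact congrArg F.toFun (tangentOfCoord_coordOfTangent he ⟨x, w⟩ hx).symm
  homogeneous y hy t ht := F.homogeneous x y hy t ht
  posDef v hv a ha := F.posDef ⟨x, v⟩ hv a ha

theorem FinslerStructure.pos (v : TangentBundle (𝓡 n) M) (hv : v.snd ≠ 0) : 0 < F.toFun v :=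
  (F.isMinkowski v.proj).pos (v := (v.snd : Eu n)) hv

theorem isUnit_det_gMat {e : OpenPartialHomeomorph M (Eu n)}
    (he : e ∈ IsManifold.maximalAtlas (𝓡 n) ∞ M) {p : Eu n × Eu n} (hx : p.1 ∈ e.target)
    (hy : p.2 ≠ 0) : IsUnit (gMat F.toFun e p).det := by
  exact (F.isMinkowski (e.symm p.1)).isUnit_det (chartInvDeriv e p.1)
    (fun _ hz => chartInvDeriv_ne_zero he hx hz) (chartInvDeriv_ne_zero he hx hy)

/-- The norm of the gradient of a vertical lift is `√(D a)` where `a` is the vector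
with `g_v(a, ·) = D`; horizontal lifts make the nonlinear connection irrelevant. -/
theorem exists_gradient_coord (D : ∀ x : M, TangentSpace (𝓡 n) x →L[ℝ] ℝ)
    {e : OpenPartialHomeomorph M (Eu n)} (he : e ∈ IsManifold.maximalAtlas (𝓡 n) ∞ M)
    {p : Eu n × Eu n} (hx : p.1 ∈ e.target) (hy : p.2 ≠ 0)
    (v : TangentBundle (𝓡 n) M) (hv : tangentOfCoord e p = v) :
    ∃ a : TangentSpace (𝓡 n) v.proj, (∀ b, fundForm F.toFun v a b = D v.proj b) ∧
      sasakiGradNorm F.toFun e p (liftCovector D e p) = √(D v.proj a) := by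
  subst hv
  have hdet := isUnit_det_gMat F he hx hy
  have hv0 : (tangentOfCoord e p).snd ≠ 0 := chartInvDeriv_ne_zero he hx hy
  have hF := (F.pos _ hv0).ne'
  set X := sasakiGrad F.toFun e p (liftCovector D e p) with hX
  have hG := F.isMinkowski (e.symm p.1)
  have key := sasaki_sasakiGrad F.toFun e p hdet hF (liftCovector D e p)
  rw [← hX] at key
  refine ⟨chartInvDeriv e p.1 X.1, fun b => ?_, ?_⟩
  · obtain ⟨b, rfl⟩ := chartInvDeriv_surjective he hx b
    -- the horizontal lift of `b`
    let Y : Eu n × Eu n :=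
      (b, WithLp.toLp 2 fun i => -∑ j, nonlinConn F.toFun e p i j * b j)
    have hY : ∀ i, deltaY F.toFun e p i Y = 0 := fun i => by simp [deltaY, Y]
    have h1 := key Y
    simp only [sasaki, hY, mul_zero, Finset.sum_const_zero, add_zero] at h1
    refine Eq.trans ?_ h1
    exact hG.halfHess_sum (chartInvDeriv e p.1) hv0 X.1 b
  · rw [sasakiGradNorm, ← hX, key X]
    rfl

end Coordinates

/-! ### The map of sphere bundles induced by a diffeomorphism -/

section SphereBundleMap

variable {n : ℕ} {M : Type*} [TopologicalSpace M] [ChartedSpace (Eu n) M]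
  {M' : Type*} [TopologicalSpace M'] [ChartedSpace (Eu n) M']

theorem SphereBundle.rep_snd_ne_zero (s : SphereBundle n M) : s.rep.snd ≠ 0 :=
  (Quotient.out (s := raySetoid n M) s).2

theorem ray_rep (s : SphereBundle n M) : ray s.rep s.rep_snd_ne_zero = s :=
  Quotient.out_eq (s := raySetoid n M) s

/-- Every nonzero vector is a positive multiple of the chosen representative of its ray. -/
theorem exists_smul_rep (v : TangentBundle (𝓡 n) M) (hv : v.snd ≠ 0) :
    ∃ t : ℝ, 0 < t ∧ v = ⟨(ray v hv).rep.proj, t • (ray v hv).rep.snd⟩ :=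
  Quotient.exact (s := raySetoid n M) (ray_rep (ray v hv))

theorem proj_ray (v : TangentBundle (𝓡 n) M) (hv : v.snd ≠ 0) :
    (ray v hv).proj = v.proj := by
  obtain ⟨t, _, h⟩ := exists_smul_rep v hv
  exact (congrArg Bundle.TotalSpace.proj h).symm

theorem mfderiv_diffeomorph_injective (f : M ≃ₘ^∞⟮𝓡 n, 𝓡 n⟯ M') (x : M) :
    Function.Injective (mfderiv (𝓡 n) (𝓡 n) f x) :=
  (f.toOpenPartialHomeomorph_mdifferentiable (by simp)).mfderiv_injective (Set.mem_univ x)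

theorem mfderiv_diffeomorph_surjective (f : M ≃ₘ^∞⟮𝓡 n, 𝓡 n⟯ M') (x : M) :
    Function.Surjective (mfderiv (𝓡 n) (𝓡 n) f x) :=
  (f.toOpenPartialHomeomorph_mdifferentiable (by simp)).mfderiv_surjective (Set.mem_univ x)

theorem mfderiv_diffeomorph_ne_zero (f : M ≃ₘ^∞⟮𝓡 n, 𝓡 n⟯ M') {x : M}
    {y : TangentSpace (𝓡 n) x} (hy : y ≠ 0) : mfderiv (𝓡 n) (𝓡 n) f x y ≠ 0 := fun h =>
  hy (mfderiv_diffeomorph_injective f x (h.trans (map_zero _).symm))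

theorem tangentMap_snd_ne_zero (f : M ≃ₘ^∞⟮𝓡 n, 𝓡 n⟯ M') {v : TangentBundle (𝓡 n) M}
    (hv : v.snd ≠ 0) : (tangentMap (𝓡 n) (𝓡 n) f v).snd ≠ 0 :=
  mfderiv_diffeomorph_ne_zero f hv

theorem tangentMap_symm_tangentMap (f : M ≃ₘ^∞⟮𝓡 n, 𝓡 n⟯ M') (v : TangentBundle (𝓡 n) M) :
    tangentMap (𝓡 n) (𝓡 n) f.symm (tangentMap (𝓡 n) (𝓡 n) f v) = v := by
  have h := tangentMap_comp_at (I := 𝓡 n) (I' := 𝓡 n) (I'' := 𝓡 n) v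
    (f.symm.mdifferentiable (by simp) _) (f.mdifferentiable (by simp) _)
  rw [← h]
  have h2 : f.symm ∘ f = id := funext fun x => f.symm_apply_apply x
  rw [h2, tangentMap_id]
  rfl

theorem tangentMap_tangentMap_symm (f : M ≃ₘ^∞⟮𝓡 n, 𝓡 n⟯ M') (v : TangentBundle (𝓡 n) M') :
    tangentMap (𝓡 n) (𝓡 n) f (tangentMap (𝓡 n) (𝓡 n) f.symm v) = v :=
  tangentMap_symm_tangentMap f.symm v

/-- The push-forward of a covector field by a diffeomorphism. -/
def pushCovector (f : M ≃ₘ^∞⟮𝓡 n, 𝓡 n⟯ M') (D : ∀ x : M, TangentSpace (𝓡 n) x →L[ℝ] ℝ) :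
    ∀ x : M', TangentSpace (𝓡 n) x →L[ℝ] ℝ := fun x =>
  (D (f.symm x)).comp (mfderiv (𝓡 n) (𝓡 n) f.symm x)

theorem pushCovector_tangentMap (f : M ≃ₘ^∞⟮𝓡 n, 𝓡 n⟯ M')
    (D : ∀ x : M, TangentSpace (𝓡 n) x →L[ℝ] ℝ) (v : TangentBundle (𝓡 n) M) :
    pushCovector f D (tangentMap (𝓡 n) (𝓡 n) f v).proj (tangentMap (𝓡 n) (𝓡 n) f v).snd =
      D v.proj v.snd :=
  congrArg (fun w : TangentBundle (𝓡 n) M => D w.proj w.snd) (tangentMap_symm_tangentMap f v)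

/-- The map of sphere bundles induced by a diffeomorphism. -/
def sphereMap (f : M ≃ₘ^∞⟮𝓡 n, 𝓡 n⟯ M') : SphereBundle n M → SphereBundle n M' :=
  Quotient.map (sa := raySetoid n M) (sb := raySetoid n M')
    (fun v => (⟨tangentMap (𝓡 n) (𝓡 n) f v.1, mfderiv_diffeomorph_ne_zero f v.2⟩ :
      SlitTangent n M')) (by
    rintro ⟨v, hv⟩ ⟨w, hw⟩ ⟨t, ht, h⟩
    dsimp only at h
    subst h
    exact ⟨t, ht, congrArg (fun y => (⟨f v.proj, y⟩ : TangentBundle (𝓡 n) M'))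
      (map_smul (mfderiv (𝓡 n) (𝓡 n) f v.proj) t v.snd)⟩)

theorem sphereMap_ray (f : M ≃ₘ^∞⟮𝓡 n, 𝓡 n⟯ M') (v : TangentBundle (𝓡 n) M) (hv : v.snd ≠ 0) :
    sphereMap f (ray v hv) =
      ray (tangentMap (𝓡 n) (𝓡 n) f v) (tangentMap_snd_ne_zero f hv) :=
  rfl

theorem ray_congr {v w : TangentBundle (𝓡 n) M} (h : v = w) (hv : v.snd ≠ 0) (hw : w.snd ≠ 0) :
    ray v hv = ray w hw := by
  subst h; rfl

theorem sphereMap_symm_sphereMap (f : M ≃ₘ^∞⟮𝓡 n, 𝓡 n⟯ M') (s : SphereBundle n M) :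
    sphereMap f.symm (sphereMap f s) = s := by
  rw [← ray_rep s, sphereMap_ray, sphereMap_ray]
  exact ray_congr (tangentMap_symm_tangentMap f s.rep) _ _

theorem proj_sphereMap (f : M ≃ₘ^∞⟮𝓡 n, 𝓡 n⟯ M') (s : SphereBundle n M) :
    (sphereMap f s).proj = f s.proj := by
  rw [← ray_rep s, sphereMap_ray, proj_ray, proj_ray]
  rfl

variable [IsManifold (𝓡 n) ∞ M] [IsManifold (𝓡 n) ∞ M']

instance : BorelSpace (SphereBundle n M) := ⟨rfl⟩

theorem continuous_sphereBundle_iff {Z : Type*} [TopologicalSpace Z] {g : SphereBundle n M → Z} :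
    Continuous g ↔ Continuous fun v : {v : TangentBundle (𝓡 n) M // v.snd ≠ 0} =>
      g (ray v.1 v.2) :=
  (isQuotientMap_quotient_mk' (s := raySetoid n M)).continuous_iff

theorem continuous_ray {Z : Type*} [TopologicalSpace Z] {g : Z → TangentBundle (𝓡 n) M}
    (hg : Continuous g) (h0 : ∀ z, (g z).snd ≠ 0) : Continuous fun z => ray (g z) (h0 z) :=
  (continuous_sphereBundle_iff.1 continuous_id).comp (hg.subtype_mk h0)

theorem continuous_sphereMap (f : M ≃ₘ^∞⟮𝓡 n, 𝓡 n⟯ M') :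
    Continuous (sphereMap f : SphereBundle n M → SphereBundle n M') := by
  rw [continuous_sphereBundle_iff]
  exact continuous_ray (((f.contMDiff.continuous_tangentMap (by simp))).comp
    continuous_subtype_val) fun v => tangentMap_snd_ne_zero f v.2

/-- The homeomorphism of sphere bundles induced by a diffeomorphism. -/
def sphereHomeomorph (f : M ≃ₘ^∞⟮𝓡 n, 𝓡 n⟯ M') : SphereBundle n M ≃ₜ SphereBundle n M' where
  toFun := sphereMap f
  invFun := sphereMap f.symm
  left_inv := sphereMap_symm_sphereMap f
  right_inv := sphereMap_symm_sphereMap f.symm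
  continuous_toFun := continuous_sphereMap f
  continuous_invFun := continuous_sphereMap f.symm

end SphereBundleMap

/-! ### The conformal factor -/

section Conformal

variable {n : ℕ} {M : Type*} [TopologicalSpace M] [ChartedSpace (Eu n) M]
  [IsManifold (𝓡 n) ∞ M]
  {M' : Type*} [TopologicalSpace M'] [ChartedSpace (Eu n) M'] [IsManifold (𝓡 n) ∞ M']

/-- `F' ∘ f_* = ρ F` for a positive function `ρ` on the base manifold `M`. -/
structure IsConformalFactor (F : FinslerStructure n M) (F' : FinslerStructure n M')
    (f : M ≃ₘ^∞⟮𝓡 n, 𝓡 n⟯ M') (ρ : M → ℝ) : Prop where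
  pos : ∀ x, 0 < ρ x
  map : ∀ v : TangentBundle (𝓡 n) M, v.snd ≠ 0 →
    F'.toFun (tangentMap (𝓡 n) (𝓡 n) f v) = ρ v.proj * F.toFun v

variable {F : FinslerStructure n M} {F' : FinslerStructure n M'}
  {f : M ≃ₘ^∞⟮𝓡 n, 𝓡 n⟯ M'} {ρ : M → ℝ}

theorem FinslerStructure.finslerAngle_eq_pi_div_two_iff (F : FinslerStructure n M)
    (v : TangentBundle (𝓡 n) M) (hv : v.snd ≠ 0) {a b : TangentSpace (𝓡 n) v.proj} (ha : a ≠ 0)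
    (hb : b ≠ 0) : finslerAngle F.toFun v a b = Real.pi / 2 ↔ fundForm F.toFun v a b = 0 := by
  rw [finslerAngle, Real.arccos_eq_pi_div_two, div_eq_zero_iff]
  exact or_iff_left (mul_pos (Real.sqrt_pos.2 (F.posDef v hv a ha))
    (Real.sqrt_pos.2 (F.posDef v hv b hb))).ne'

/-- A conformal diffeomorphism scales the Finsler function by a function on the base. -/
theorem IsConformal.exists_factor (hn : 2 ≤ n) (hf : IsConformal F F' f) :
    ∃ ρ : M → ℝ, IsConformalFactor F F' f ρ := by
  have hrank : 1 < Module.rank ℝ (Eu n) := by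
    rw [rank_eq_card_basis (EuclideanSpace.basisFun (Fin n) ℝ).toBasis]
    simpa using (show 1 < n by omega)
  have h : ∀ x : M, ∃ c : ℝ, 0 < c ∧ ∀ y : Eu n, y ≠ 0 →
      F'.toFun (tangentMap (𝓡 n) (𝓡 n) f ⟨x, y⟩) = c * F.toFun ⟨x, y⟩ := by
    intro x
    refine exists_const_of_orthogonal hrank (F.isMinkowski x) (F'.isMinkowski (f x))
      (mfderiv (𝓡 n) (𝓡 n) f x) (fun y hy => mfderiv_diffeomorph_ne_zero f hy) ?_
    intro v hv a b ha hb hab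
    refine (F'.finslerAngle_eq_pi_div_two_iff (tangentMap (𝓡 n) (𝓡 n) f ⟨x, v⟩)
      (mfderiv_diffeomorph_ne_zero f hv) (mfderiv_diffeomorph_ne_zero f ha)
      (mfderiv_diffeomorph_ne_zero f hb)).1 ?_
    exact (hf ⟨x, v⟩ hv a b ha hb).trans
      ((F.finslerAngle_eq_pi_div_two_iff ⟨x, v⟩ hv ha hb).2 hab)
  choose ρ hρ h using h
  exact ⟨ρ, hρ, fun v hv => h v.proj v.snd hv⟩

theorem IsConformalFactor.symm (h : IsConformalFactor F F' f ρ) :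
    IsConformalFactor F' F f.symm fun x => (ρ (f.symm x))⁻¹ where
  pos x := inv_pos.2 (h.pos _)
  map v hv := by
    have h1 := h.map (tangentMap (𝓡 n) (𝓡 n) f.symm v) (tangentMap_snd_ne_zero f.symm hv)
    rw [tangentMap_tangentMap_symm] at h1
    rw [h1]
    change _ = (ρ (f.symm v.proj))⁻¹ * (ρ (f.symm v.proj) * _)
    rw [inv_mul_cancel_left₀ (h.pos _).ne']

theorem IsConformalFactor.fundForm_map (h : IsConformalFactor F F' f ρ)
    (v : TangentBundle (𝓡 n) M) (hv : v.snd ≠ 0) (a b : TangentSpace (𝓡 n) v.proj) :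
    fundForm F'.toFun (tangentMap (𝓡 n) (𝓡 n) f v) (mfderiv (𝓡 n) (𝓡 n) f v.proj a)
      (mfderiv (𝓡 n) (𝓡 n) f v.proj b) = ρ v.proj ^ 2 * fundForm F.toFun v a b :=
  halfHess_map (F.isMinkowski v.proj) (F'.isMinkowski (f v.proj))
    (mfderiv (𝓡 n) (𝓡 n) f v.proj) (fun _ hy => mfderiv_diffeomorph_ne_zero f hy) (ρ v.proj)
    (fun y hy => h.map ⟨v.proj, y⟩ hy) hv a b

/-- The gradient norm at a ray can be computed from any vector `v` of the ray: it is `√(D a)`, where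
`g_v(a, ·) = D`. -/
theorem exists_gradient (F : FinslerStructure n M) (D : ∀ x : M, TangentSpace (𝓡 n) x →L[ℝ] ℝ)
    (v : TangentBundle (𝓡 n) M) (hv : v.snd ≠ 0) :
    ∃ a : TangentSpace (𝓡 n) v.proj, (∀ b, fundForm F.toFun v a b = D v.proj b) ∧
      gradNorm F.toFun D (ray v hv) = √(D v.proj a) := by
  set s := ray v hv with hs
  have he : chartAt (Eu n) s.proj ∈ IsManifold.maximalAtlas (𝓡 n) ∞ M :=
    IsManifold.chart_mem_maximalAtlas s.proj
  have hx := mem_chart_source (Eu n) s.proj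
  obtain ⟨a, ha, h⟩ := exists_gradient_coord F D he
    (p := coordOfTangent (chartAt (Eu n) s.proj) s.rep)
    ((chartAt (Eu n) s.proj).map_source hx)
    (fun h0 => s.rep_snd_ne_zero
      ((mdifferentiable_of_mem_maximalAtlas he).mfderiv_injective hx (h0.trans (map_zero _).symm)))
    s.rep (tangentOfCoord_coordOfTangent he s.rep hx)
  have hs0 := s.rep_snd_ne_zero
  obtain ⟨t, ht, hvt⟩ := exists_smul_rep v hv
  rw [← hs] at hvt
  clear_value s
  subst hvt
  refine ⟨a, fun b => ?_, h⟩
  rw [← ha b]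
  exact (F.isMinkowski s.rep.proj).halfHess_smul hs0 ht a b

/-- A conformal map with factor `ρ` divides the norm of gradients of vertical lifts by `ρ`. -/
theorem IsConformalFactor.gradNorm_map (h : IsConformalFactor F F' f ρ)
    (D : ∀ x : M, TangentSpace (𝓡 n) x →L[ℝ] ℝ) (s : SphereBundle n M) :
    ρ s.proj * gradNorm F'.toFun (pushCovector f D) (sphereMap f s) = gradNorm F.toFun D s := by
  have hv := s.rep_snd_ne_zero
  obtain ⟨a, ha, h1⟩ := exists_gradient F D s.rep hv
  obtain ⟨a', ha', h2⟩ := exists_gradient F' (pushCovector f D)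
    (tangentMap (𝓡 n) (𝓡 n) f s.rep) (tangentMap_snd_ne_zero f hv)
  rw [← sphereMap_ray f s.rep hv] at h2
  rw [ray_rep] at h1 h2
  -- `c` is the gradient on `M'` carried back to `M`, and equals `ρ⁻² a`
  obtain ⟨c, hc⟩ := mfderiv_diffeomorph_surjective f s.rep.proj a'
  have hD : ∀ b : TangentSpace (𝓡 n) s.rep.proj,
      pushCovector f D (f s.rep.proj) (mfderiv (𝓡 n) (𝓡 n) f s.rep.proj b) = D s.rep.proj b :=
    fun b => pushCovector_tangentMap f D ⟨s.rep.proj, b⟩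
  have hg : ∀ b : TangentSpace (𝓡 n) s.rep.proj,
      ρ s.rep.proj ^ 2 * fundForm F.toFun s.rep c b = D s.rep.proj b := by
    intro b
    rw [← h.fundForm_map s.rep hv c b, hc, ← hD b]
    exact ha' _
  have e2 : pushCovector f D (tangentMap (𝓡 n) (𝓡 n) f s.rep).proj a' = D s.rep.proj c := by
    rw [← hc]; exact hD c
  have e1 : D s.rep.proj a = ρ s.rep.proj ^ 2 * D s.rep.proj c := by
    rw [← hg a, ← ha c]
    congr 1
    exact (F.isMinkowski s.rep.proj).halfHess_symm hv c a
  rw [h1, h2, e2, e1, Real.sqrt_mul (sq_nonneg _), Real.sqrt_sq (h.pos _).le]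
  rfl

end Conformal

/-! ### Charts and generalized differentials under a diffeomorphism -/

section Charts

variable {n : ℕ} {M : Type*} [TopologicalSpace M] [ChartedSpace (Eu n) M]
  {M' : Type*} [TopologicalSpace M'] [ChartedSpace (Eu n) M']

/-- The chart `e ∘ f` of `M` obtained from a chart `e` of `M'`; it has the same target. -/
def pullChart (f : M ≃ₘ^∞⟮𝓡 n, 𝓡 n⟯ M') (e : OpenPartialHomeomorph M' (Eu n)) :
    OpenPartialHomeomorph M (Eu n) :=
  f.toHomeomorph.transOpenPartialHomeomorph e

theorem tangentOfCoord_pullChart (f : M ≃ₘ^∞⟮𝓡 n, 𝓡 n⟯ M')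
    {e : OpenPartialHomeomorph M' (Eu n)} (he : e ∈ IsManifold.maximalAtlas (𝓡 n) ∞ M')
    {p : Eu n × Eu n} (hp : p.1 ∈ e.target) :
    tangentOfCoord (pullChart f e) p = tangentMap (𝓡 n) (𝓡 n) f.symm (tangentOfCoord e p) :=
  tangentMap_comp_at (I := 𝓡 n) (I' := 𝓡 n) (I'' := 𝓡 n)
    (⟨p.1, p.2⟩ : TangentBundle (𝓡 n) (Eu n)) (f.symm.mdifferentiable (by simp) _)
    ((mdifferentiable_of_mem_maximalAtlas he).mdifferentiableAt_symm hp)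

theorem tangentMap_tangentOfCoord_pullChart (f : M ≃ₘ^∞⟮𝓡 n, 𝓡 n⟯ M')
    {e : OpenPartialHomeomorph M' (Eu n)} (he : e ∈ IsManifold.maximalAtlas (𝓡 n) ∞ M')
    {p : Eu n × Eu n} (hp : p.1 ∈ e.target) :
    tangentMap (𝓡 n) (𝓡 n) f (tangentOfCoord (pullChart f e) p) = tangentOfCoord e p := by
  rw [tangentOfCoord_pullChart f he hp, tangentMap_tangentMap_symm]

variable [IsManifold (𝓡 n) ∞ M]

theorem pullChart_mem (f : M ≃ₘ^∞⟮𝓡 n, 𝓡 n⟯ M') {e : OpenPartialHomeomorph M' (Eu n)}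
    (he : e ∈ IsManifold.maximalAtlas (𝓡 n) ∞ M') :
    pullChart f e ∈ IsManifold.maximalAtlas (𝓡 n) ∞ M := by
  refine OpenPartialHomeomorph.mem_maximalAtlas_of_contMDiffOn _ ?_ ?_
  · exact (contMDiffOn_of_mem_maximalAtlas he).comp f.contMDiff.contMDiffOn fun _ h => h
  · exact f.symm.contMDiff.comp_contMDiffOn (contMDiffOn_symm_of_mem_maximalAtlas he)

variable [IsManifold (𝓡 n) ∞ M']

/-- Generalized differentials are carried over by diffeomorphisms, because the charts `e` of `M'` and
`e ∘ f` of `M` have the same coordinate expressions. -/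
theorem IsGenDifferential.push (f : M ≃ₘ^∞⟮𝓡 n, 𝓡 n⟯ M') {u : M → ℝ}
    {D : ∀ x : M, TangentSpace (𝓡 n) x →L[ℝ] ℝ} (h : IsGenDifferential u D) :
    IsGenDifferential (u ∘ f.symm) (pushCovector f D) := by
  intro e he i
  obtain ⟨h1, h2⟩ := h (pullChart f e) (pullChart_mem f he) i
  have key : ∀ x ∈ e.target, D ((pullChart f e).symm x)
      (chartInvDeriv (pullChart f e) x (stdVec i)) =
      pushCovector f D (e.symm x) (chartInvDeriv e x (stdVec i)) := fun x hx =>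
    congrArg (fun v : TangentBundle (𝓡 n) M => D v.proj v.snd)
      (tangentOfCoord_pullChart f he (p := (x, stdVec i)) hx)
  refine ⟨fun K hK hKe => ?_, fun ψ hψ hc hs => ?_⟩
  · refine (memLp_congr_ae ?_).1 (h1 K hK hKe)
    filter_upwards [ae_restrict_mem hK.measurableSet] with x hx using key x (hKe hx)
  · have h3 := h2 ψ hψ hc hs
    have h4 : ∫ x in e.target, D ((pullChart f e).symm x)
        (chartInvDeriv (pullChart f e) x (stdVec i)) * ψ x =
        ∫ x in e.target, pushCovector f D (e.symm x) (chartInvDeriv e x (stdVec i)) * ψ x :=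
      setIntegral_congr_fun e.open_target.measurableSet fun x hx => by
        simp only [key x hx]
    rw [← h4]
    exact h3

end Charts

/-! ### The Hilbert form and the volume coefficient under a conformal map -/

section HilbertForm

theorem isOpen_rayDomain {n : ℕ} {M : Type*} [TopologicalSpace M]
    (e : OpenPartialHomeomorph M (Eu n)) (k : Fin n) :
    IsOpen (e.target ×ˢ (Set.univ : Set ({j : Fin n // j ≠ k} → ℝ))) :=
  e.open_target.prod isOpen_univ

variable {n : ℕ} {M : Type*} [TopologicalSpace M] [ChartedSpace (Eu n) M]
  [IsManifold (𝓡 n) ∞ M]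

theorem contDiff_rayVec (k : Fin n) (ε : ℤˣ) : ContDiff ℝ ∞ (rayVec k ε) := by
  rw [contDiff_euclidean]
  intro j
  by_cases h : j = k
  · simp only [rayVec, h, dite_true]
    exact contDiff_const
  · simp only [rayVec, h, dite_false]
    fun_prop

/-- By Euler's identity the Hilbert form is the vertical derivative of the Finsler function:
`ω = F_{y^i} dx^i`. -/
theorem hilbertLocal_eq_fderiv (F : FinslerStructure n M) {e : OpenPartialHomeomorph M (Eu n)}
    (he : e ∈ IsManifold.maximalAtlas (𝓡 n) ∞ M) (k : Fin n) (ε : ℤˣ) (w : RayCoord n k)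
    (hw : w.1 ∈ e.target) :
    hilbertLocal F.toFun e k ε w =
      ContinuousAlternatingMap.ofSubsingletonLIE (0 : Fin 1)
        ((fderiv ℝ (fun p => F.toFun (tangentOfCoord e p)) (w.1, rayVec k ε w.2)).comp
          ((ContinuousLinearMap.inr ℝ (Eu n) (Eu n)).comp
            (ContinuousLinearMap.fst ℝ (Eu n) ({j : Fin n // j ≠ k} → ℝ)))) := by
  have hr := rayVec_ne_zero k ε w.2
  have hv := chartInvDeriv_ne_zero he hw hr
  have hG := F.isMinkowski (e.symm w.1)
  let A : Eu n →L[ℝ] Eu n := chartInvDeriv e w.1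
  have hopen : (e.target ×ˢ {0}ᶜ : Set (Eu n × Eu n)) ∈ nhds (w.1, rayVec k ε w.2) :=
    (e.open_target.prod isOpen_compl_singleton).mem_nhds ⟨hw, hr⟩
  have d1 : HasFDerivAt (fun y : Eu n => F.toFun (tangentOfCoord e (w.1, y))) _
      (rayVec k ε w.2) :=
    HasFDerivAt.comp (g := fun z : Eu n => F.toFun ⟨e.symm w.1, z⟩) (f := A) (rayVec k ε w.2)
      ((hG.contDiffAt hv).differentiableAt (by simp)).hasFDerivAt A.hasFDerivAt
  have d2 : HasFDerivAt (fun y : Eu n => F.toFun (tangentOfCoord e (w.1, y))) _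
      (rayVec k ε w.2) :=
    HasFDerivAt.comp (g := fun p => F.toFun (tangentOfCoord e p)) (f := fun y => (w.1, y))
      (rayVec k ε w.2)
      (((F.contDiffOn_coord he).contDiffAt hopen).differentiableAt (by simp)).hasFDerivAt
      (hasFDerivAt_prodMk_right w.1 (rayVec k ε w.2))
  have h3 := d1.unique d2
  ext X
  exact (hG.halfHess_inv_smul_self hv (A (X 0).1)).trans
    (congrArg (fun T : Eu n →L[ℝ] ℝ => T (X 0).1) h3)

theorem contDiffOn_hilbertLocal (F : FinslerStructure n M) {e : OpenPartialHomeomorph M (Eu n)}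
    (he : e ∈ IsManifold.maximalAtlas (𝓡 n) ∞ M) (k : Fin n) (ε : ℤˣ) :
    ContDiffOn ℝ ∞ (hilbertLocal F.toFun e k ε) (e.target ×ˢ Set.univ) := by
  have h1 := (F.contDiffOn_coord he).fderiv_of_isOpen (m := ∞)
    (e.open_target.prod isOpen_compl_singleton) (by simp)
  have h2 : ContDiff ℝ ∞ (fun w : RayCoord n k => (w.1, rayVec k ε w.2)) :=
    contDiff_fst.prodMk ((contDiff_rayVec k ε).comp contDiff_snd)
  have h3 := h1.comp h2.contDiffOn (s := e.target ×ˢ Set.univ)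
    (fun w hw => ⟨hw.1, rayVec_ne_zero k ε w.2⟩)
  have h4 := (h3.clm_comp (contDiffOn_const (c := (ContinuousLinearMap.inr ℝ (Eu n) (Eu n)).comp
            (ContinuousLinearMap.fst ℝ (Eu n) ({j : Fin n // j ≠ k} → ℝ)))))
  refine ((ContinuousAlternatingMap.ofSubsingletonLIE (𝕜 := ℝ) (E := RayCoord n k)
    (F := ℝ) (0 : Fin 1)).contDiff.comp_contDiffOn h4).congr fun w hw => ?_
  exact hilbertLocal_eq_fderiv F he k ε w hw.1

theorem continuousOn_volCoeff (F : FinslerStructure n M) {e : OpenPartialHomeomorph M (Eu n)}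
    (he : e ∈ IsManifold.maximalAtlas (𝓡 n) ∞ M) (k : Fin n) (ε : ℤˣ) :
    ContinuousOn (volCoeff F.toFun e k ε) (e.target ×ˢ Set.univ) := by
  have h := contDiffOn_hilbertLocal F he k ε
  have h1 : ∀ v, ContinuousOn (fun w => hilbertLocal F.toFun e k ε w v)
      (e.target ×ˢ Set.univ) := fun v =>
    (ContinuousAlternatingMap.apply ℝ (RayCoord n k) ℝ v).continuous.comp_continuousOn
      h.continuousOn
  have h2 : ∀ v a, ContinuousOn
      (fun w => fderiv ℝ (fun w => hilbertLocal F.toFun e k ε w v) w a)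
      (e.target ×ˢ Set.univ) := fun v a =>
    (((ContinuousAlternatingMap.apply ℝ (RayCoord n k) ℝ v).contDiff.comp_contDiffOn
      h).continuousOn_fderiv_of_isOpen (isOpen_rayDomain e k) (by simp)).clm_apply
      continuousOn_const
  have h3 : ∀ a b, ContinuousOn (fun w => extDeriv (hilbertLocal F.toFun e k ε) w ![a, b])
      (e.target ×ˢ Set.univ) := fun a b =>
    ((h2 ![b] a).sub (h2 ![a] b)).congr fun w hw =>
      extDeriv_apply_pair (((h w hw).contDiffAt ((isOpen_rayDomain e k).mem_nhds
        hw)).differentiableAt (by simp)) a b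
  unfold volCoeff wedgePow
  refine continuousOn_const.mul (continuousOn_const.mul (continuousOn_finsetSum _ fun σ _ => ?_))
  exact (continuousOn_const.mul (h1 _)).mul (continuousOn_finsetProd _ fun i _ => h3 _ _)

variable {M' : Type*} [TopologicalSpace M'] [ChartedSpace (Eu n) M'] [IsManifold (𝓡 n) ∞ M']
  {F : FinslerStructure n M} {F' : FinslerStructure n M'}
  {f : M ≃ₘ^∞⟮𝓡 n, 𝓡 n⟯ M'} {ρ : M → ℝ}

theorem IsConformalFactor.coord (h : IsConformalFactor F F' f ρ)
    {e : OpenPartialHomeomorph M' (Eu n)} (he : e ∈ IsManifold.maximalAtlas (𝓡 n) ∞ M')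
    {p : Eu n × Eu n} (hp : p.1 ∈ e.target) (hy : p.2 ≠ 0) :
    F'.toFun (tangentOfCoord e p) =
      ρ ((pullChart f e).symm p.1) * F.toFun (tangentOfCoord (pullChart f e) p) := by
  rw [← tangentMap_tangentOfCoord_pullChart f he hp]
  exact h.map _ (chartInvDeriv_ne_zero (pullChart_mem f he) hp hy)

/-- The conformal factor is differentiable, being the quotient of the Finsler functions along a
coordinate vector field. -/
theorem IsConformalFactor.differentiableAt (h : IsConformalFactor F F' f ρ) (hn : 0 < n)
    {e : OpenPartialHomeomorph M' (Eu n)} (he : e ∈ IsManifold.maximalAtlas (𝓡 n) ∞ M')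
    {x : Eu n} (hx : x ∈ e.target) :
    DifferentiableAt ℝ (fun x => ρ ((pullChart f e).symm x)) x := by
  have he' := pullChart_mem f he
  set y : Eu n := stdVec ⟨0, hn⟩ with hy
  have hy0 : y ≠ 0 := by simp [hy, stdVec]
  have hopen : (e.target ×ˢ {0}ᶜ : Set (Eu n × Eu n)) ∈ nhds (x, y) :=
    (e.open_target.prod isOpen_compl_singleton).mem_nhds ⟨hx, hy0⟩
  have hxy : DifferentiableAt ℝ (fun x : Eu n => (x, y)) x := by fun_prop
  have d1 : DifferentiableAt ℝ (fun x => F'.toFun (tangentOfCoord e (x, y))) x :=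
    DifferentiableAt.comp (g := fun p => F'.toFun (tangentOfCoord e p)) x
      (((F'.contDiffOn_coord he).contDiffAt hopen).differentiableAt (by simp)) hxy
  have d2 : DifferentiableAt ℝ (fun x => F.toFun (tangentOfCoord (pullChart f e) (x, y))) x :=
    DifferentiableAt.comp (g := fun p => F.toFun (tangentOfCoord (pullChart f e) p)) x
      (((F.contDiffOn_coord he').contDiffAt hopen).differentiableAt (by simp)) hxy
  have hpos : ∀ z ∈ e.target, F.toFun (tangentOfCoord (pullChart f e) (z, y)) ≠ 0 := fun z hz =>
    (F.pos _ (chartInvDeriv_ne_zero he' hz hy0)).ne'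
  refine (d1.fun_mul (d2.fun_inv (hpos x hx))).congr_of_eventuallyEq ?_
  filter_upwards [e.open_target.mem_nhds hx] with z hz
  rw [h.coord he (p := (z, y)) hz hy0, mul_inv_cancel_right₀ (hpos z hz)]

/-- The Hilbert form is multiplied by `ρ`: it involves vertical derivatives only, for which `ρ` is
constant. -/
theorem IsConformalFactor.hilbertLocal_eq (h : IsConformalFactor F F' f ρ) (hn : 0 < n)
    {e : OpenPartialHomeomorph M' (Eu n)} (he : e ∈ IsManifold.maximalAtlas (𝓡 n) ∞ M')
    (k : Fin n) (ε : ℤˣ) (w : RayCoord n k) (hw : w.1 ∈ e.target) :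
    hilbertLocal F'.toFun e k ε w = ρ ((pullChart f e).symm w.1) •
      hilbertLocal F.toFun (pullChart f e) k ε w := by
  have he' := pullChart_mem f he
  have hr := rayVec_ne_zero k ε w.2
  rw [hilbertLocal_eq_fderiv F' he k ε w hw, hilbertLocal_eq_fderiv F he' k ε w hw, ← map_smul]
  congr 1
  have hopen : (e.target ×ˢ {0}ᶜ : Set (Eu n × Eu n)) ∈ nhds (w.1, rayVec k ε w.2) :=
    (e.open_target.prod isOpen_compl_singleton).mem_nhds ⟨hw, hr⟩
  have h1 : (fun p => F'.toFun (tangentOfCoord e p)) =ᶠ[nhds (w.1, rayVec k ε w.2)]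
      fun p => ρ ((pullChart f e).symm p.1) * F.toFun (tangentOfCoord (pullChart f e) p) := by
    filter_upwards [hopen] with p hp using h.coord he hp.1 hp.2
  have d1 : HasFDerivAt (fun p : Eu n × Eu n => ρ ((pullChart f e).symm p.1)) _
      (w.1, rayVec k ε w.2) :=
    HasFDerivAt.comp (g := fun x => ρ ((pullChart f e).symm x)) (f := Prod.fst)
      (w.1, rayVec k ε w.2) (h.differentiableAt hn he hw).hasFDerivAt hasFDerivAt_fst
  have d2 := (((F.contDiffOn_coord he').contDiffAt hopen).differentiableAt (by simp)).hasFDerivAt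
  rw [h1.fderiv_eq (𝕜 := ℝ), (d1.fun_mul d2).fderiv]
  ext X <;> simp

/-- Under a conformal map the coefficient of the volume element is multiplied by `ρ^n`: in
`ω' ∧ (dω')^{n-1}` with `ω' = ρ ω`, the terms with `dρ ∧ ω` drop out. -/
theorem IsConformalFactor.volCoeff_eq (h : IsConformalFactor F F' f ρ) (hn : 0 < n)
    {e : OpenPartialHomeomorph M' (Eu n)} (he : e ∈ IsManifold.maximalAtlas (𝓡 n) ∞ M')
    (k : Fin n) (ε : ℤˣ) (w : RayCoord n k) (hw : w.1 ∈ e.target) :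
    volCoeff F'.toFun e k ε w = ρ ((pullChart f e).symm w.1) ^ n *
      volCoeff F.toFun (pullChart f e) k ε w := by
  have he' := pullChart_mem f he
  have hopen : e.target ×ˢ Set.univ ∈ nhds w := (isOpen_rayDomain e k).mem_nhds ⟨hw, trivial⟩
  set r : RayCoord n k → ℝ := fun w => ρ ((pullChart f e).symm w.1)
  have h1 : hilbertLocal F'.toFun e k ε =ᶠ[nhds w]
      fun w => r w • hilbertLocal F.toFun (pullChart f e) k ε w := by
    filter_upwards [hopen] with w hw using h.hilbertLocal_eq hn he k ε w hw.1
  have d1 : DifferentiableAt ℝ r w :=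
    DifferentiableAt.comp (g := fun x => ρ ((pullChart f e).symm x)) w
      (h.differentiableAt hn he hw) differentiableAt_fst
  have d2 : DifferentiableAt ℝ (hilbertLocal F.toFun (pullChart f e) k ε) w :=
    ((contDiffOn_hilbertLocal F he' k ε).contDiffAt hopen).differentiableAt (by simp)
  have h2 : ∀ a b, extDeriv (hilbertLocal F'.toFun e k ε) w ![a, b] =
      r w * extDeriv (hilbertLocal F.toFun (pullChart f e) k ε) w ![a, b] +
        (fderiv ℝ r w a * hilbertLocal F.toFun (pullChart f e) k ε w ![b] -
          fderiv ℝ r w b * hilbertLocal F.toFun (pullChart f e) k ε w ![a]) := by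
    intro a b
    have d3 : ∀ v, DifferentiableAt ℝ
        (fun w => hilbertLocal F.toFun (pullChart f e) k ε w v) w := fun v =>
      (ContinuousAlternatingMap.apply ℝ (RayCoord n k) ℝ v).differentiableAt.comp w d2
    rw [h1.extDeriv_eq, extDeriv_apply_pair (d1.fun_smul d2), extDeriv_apply_pair d2]
    simp only [ContinuousAlternatingMap.smul_apply, smul_eq_mul]
    rw [fderiv_fun_mul d1 (d3 _), fderiv_fun_mul d1 (d3 _)]
    simp only [add_apply, smul_apply, smul_eq_mul]
    ring
  rw [volCoeff, h1.eq_of_nhds, wedgePow_smul, wedgePow_add_wedge (n - 1) _ _ _ _ _ h2, volCoeff]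
  have h3 : r w ^ n = r w * r w ^ (n - 1) := by
    rw [← pow_succ', Nat.sub_add_cancel hn]
  rw [show ρ ((pullChart f e).symm w.1) = r w from rfl, h3]
  ring

end HilbertForm

/-! ### The volume measure under a conformal map -/

section MeasureLemmas

variable {α β : Type*} [MeasurableSpace α] [MeasurableSpace β]

theorem MeasurableEmbedding.comap_withDensity {g : α → β} (hg : MeasurableEmbedding g)
    (μ : Measure β) (φ : β → ENNReal) :
    (μ.withDensity φ).comap g = (μ.comap g).withDensity (φ ∘ g) := by
  ext s hs
  rw [hg.comap_apply, withDensity_apply _ (hg.measurableSet_image.2 hs), withDensity_apply _ hs,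
    hg.restrict_comap]
  change _ = ∫⁻ a, φ (g a) ∂_
  rw [← hg.lintegral_map, hg.map_comap, Measure.restrict_restrict hg.measurableSet_range,
    Set.inter_eq_self_of_subset_right (Set.image_subset_range g s)]

theorem MeasureTheory.Measure.withDensity_map {g : α → β} (hg : Measurable g) (μ : Measure α)
    {φ : β → ENNReal} (hφ : Measurable φ) :
    (μ.map g).withDensity φ = (μ.withDensity (φ ∘ g)).map g := by
  ext s hs
  rw [withDensity_apply _ hs, Measure.map_apply hg hs, withDensity_apply _ (hg hs),
    setLIntegral_map hs hφ hg]
  rfl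

theorem MeasureTheory.withDensity_mono_measure {μ ν : Measure α} (h : μ ≤ ν) (φ : α → ENNReal) :
    μ.withDensity φ ≤ ν.withDensity φ := by
  refine Measure.le_iff.2 fun s hs => ?_
  rw [withDensity_apply _ hs, withDensity_apply _ hs]
  exact lintegral_mono' (Measure.restrict_mono le_rfl h) le_rfl

end MeasureLemmas

section Volume

variable {n : ℕ} {M : Type*} [TopologicalSpace M] [ChartedSpace (Eu n) M]
  [IsManifold (𝓡 n) ∞ M]

theorem continuous_rayParam (e : IsManifold.maximalAtlas (𝓡 n) ∞ M) (k : Fin n) (ε : ℤˣ) :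
    Continuous (rayParam e k ε) := by
  refine continuous_ray ?_ _
  have h1 := (contMDiffOn_tangentOfCoord e.2).continuousOn
  have h2 : Continuous fun w : {w : RayCoord n k // w.1 ∈ e.1.target} =>
      (w.1.1, rayVec k ε w.1.2) :=
    (continuous_fst.comp continuous_subtype_val).prodMk
      ((contDiff_rayVec k ε).continuous.comp (continuous_snd.comp continuous_subtype_val))
  exact h1.comp_continuous h2 fun w => ⟨w.2, trivial⟩

variable {M' : Type*} [TopologicalSpace M'] [ChartedSpace (Eu n) M'] [IsManifold (𝓡 n) ∞ M']
  {F : FinslerStructure n M} {F' : FinslerStructure n M'}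
  {f : M ≃ₘ^∞⟮𝓡 n, 𝓡 n⟯ M'} {ρ : M → ℝ}

/-- The conformal factor is continuous on the sphere bundle, being a quotient of Finsler
functions there. -/
theorem IsConformalFactor.continuous_proj (h : IsConformalFactor F F' f ρ) :
    Continuous fun s : SphereBundle n M => ρ s.proj := by
  rw [continuous_sphereBundle_iff]
  simp only [proj_ray]
  have h1 : Continuous fun v : {v : TangentBundle (𝓡 n) M // v.snd ≠ 0} =>
      F'.toFun (tangentMap (𝓡 n) (𝓡 n) f v.1) :=
    F'.smooth.continuousOn.comp_continuous
      ((f.contMDiff.continuous_tangentMap (by simp)).comp continuous_subtype_val)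
      fun v => tangentMap_snd_ne_zero f v.2
  have h2 : Continuous fun v : {v : TangentBundle (𝓡 n) M // v.snd ≠ 0} => F.toFun v.1 :=
    F.smooth.continuousOn.comp_continuous continuous_subtype_val fun v => v.2
  refine (h1.div h2 fun v => (F.pos v.1 v.2).ne').congr fun v => ?_
  rw [Pi.div_apply, h.map v.1 v.2, mul_div_cancel_right₀ _ (F.pos v.1 v.2).ne']

theorem IsConformalFactor.measurable_density (h : IsConformalFactor F F' f ρ) :
    Measurable fun s : SphereBundle n M => ENNReal.ofReal (ρ s.proj ^ n) :=
  (h.continuous_proj.measurable.pow_const n).ennreal_ofReal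

theorem sphereMap_rayParam (f : M ≃ₘ^∞⟮𝓡 n, 𝓡 n⟯ M')
    (e : IsManifold.maximalAtlas (𝓡 n) ∞ M') (k : Fin n) (ε : ℤˣ)
    (w : {w : RayCoord n k // w.1 ∈ e.1.target}) :
    sphereMap f (rayParam ⟨pullChart f e.1, pullChart_mem f e.2⟩ k ε w) = rayParam e k ε w :=
  ray_congr (tangentMap_tangentOfCoord_pullChart f e.2 w.2) _ _

/-- On corresponding coordinate domains, the volume of `(M', F')` is the image of `ρ^n` times the
volume of `(M, F)`. -/
theorem IsConformalFactor.localVolume_eq (h : IsConformalFactor F F' f ρ) (hn : 0 < n)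
    (e : IsManifold.maximalAtlas (𝓡 n) ∞ M') (k : Fin n) (ε : ℤˣ) :
    localVolume F'.toFun e k ε =
      ((localVolume F.toFun ⟨pullChart f e.1, pullChart_mem f e.2⟩ k ε).withDensity
        fun s => ENNReal.ofReal (ρ s.proj ^ n)).map (sphereMap f) := by
  set e₀ : IsManifold.maximalAtlas (𝓡 n) ∞ M := ⟨pullChart f e.1, pullChart_mem f e.2⟩
  have hemb : MeasurableEmbedding
      (Subtype.val : {w : RayCoord n k // w.1 ∈ e.1.target} → RayCoord n k) :=
    MeasurableEmbedding.subtype_coe (e.1.open_target.preimage continuous_fst).measurableSet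
  have hdens : Measurable ((fun w => ENNReal.ofReal |volCoeff F.toFun e₀.1 k ε w|) ∘
      (Subtype.val : {w : RayCoord n k // w.1 ∈ e.1.target} → RayCoord n k)) :=
    (ENNReal.continuous_ofReal.comp ((continuousOn_volCoeff F e₀.2 k ε).abs.comp_continuous
      continuous_subtype_val fun w => ⟨w.2, trivial⟩)).measurable
  -- the domains of both ray parametrizations are the same
  let g : {w : RayCoord n k // w.1 ∈ e.1.target} → SphereBundle n M := rayParam e₀ k ε
  have hgm : Measurable g := (continuous_rayParam e₀ k ε).measurable
  have hsm : Measurable (sphereMap f : SphereBundle n M → SphereBundle n M') :=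
    (continuous_sphereMap f).measurable
  have hR := h.measurable_density
  have hproj : ∀ w, (g w).proj = (pullChart f e.1).symm w.1.1 := fun w => proj_ray _ _
  have hcomp : sphereMap f ∘ g = rayParam e k ε := funext fun w => sphereMap_rayParam f e k ε w
  have h1 : localVolume F.toFun e₀ k ε = Measure.map g
      ((Measure.comap Subtype.val volume).withDensity
        ((fun w => ENNReal.ofReal |volCoeff F.toFun e₀.1 k ε w|) ∘ Subtype.val)) :=
    congrArg (Measure.map g) (hemb.comap_withDensity volume _)
  rw [h1, localVolume, hemb.comap_withDensity, Measure.withDensity_map hgm _ hR,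
    ← withDensity_mul _ hdens (hR.comp hgm), Measure.map_map hsm hgm, hcomp]
  congr 2
  ext w
  simp only [Function.comp_apply, Pi.mul_apply]
  rw [h.volCoeff_eq hn e.2 k ε w.1 w.2, abs_mul, abs_of_pos (pow_pos (h.pos _) n), mul_comm,
    ENNReal.ofReal_mul (abs_nonneg _), hproj]

/-- The volume of `(M', F')` is at most the image of `ρ^n` times the volume of `(M, F)`. Equality
holds by symmetry, but one inequality suffices: the energy estimate is applied to `f` and to its
inverse. -/
theorem IsConformalFactor.sphereVolume_le (h : IsConformalFactor F F' f ρ) (hn : 0 < n) :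
    sphereVolume F'.toFun ≤
      ((sphereVolume F.toFun).withDensity
        fun s => ENNReal.ofReal (ρ s.proj ^ n)).map (sphereMap f) := by
  refine iSup_le fun e => iSup_le fun k => iSup_le fun ε => ?_
  rw [h.localVolume_eq hn e k ε]
  refine Measure.map_mono (withDensity_mono_measure ?_ _) (continuous_sphereMap f).measurable
  exact (le_iSup_of_le ⟨pullChart f e.1, pullChart_mem f e.2⟩
    (le_iSup_of_le k (le_iSup_of_le ε le_rfl)))

end Volume

/-! ### Energy and capacities under a conformal map -/

section Energy

variable {n : ℕ} {M : Type*} [TopologicalSpace M] [ChartedSpace (Eu n) M]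
  [IsManifold (𝓡 n) ∞ M]
  {M' : Type*} [TopologicalSpace M'] [ChartedSpace (Eu n) M'] [IsManifold (𝓡 n) ∞ M']
  {F : FinslerStructure n M} {F' : FinslerStructure n M'}
  {f : M ≃ₘ^∞⟮𝓡 n, 𝓡 n⟯ M'} {ρ : M → ℝ}

theorem measurableEmbedding_sphereMap (f : M ≃ₘ^∞⟮𝓡 n, 𝓡 n⟯ M') :
    MeasurableEmbedding (sphereMap f : SphereBundle n M → SphereBundle n M') :=
  (sphereHomeomorph f).measurableEmbedding

/-- The factor `ρ^n` of the volume cancels the factor `ρ^{-n}` of `|∇ u^V|^n`. -/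
theorem IsConformalFactor.energy_le (h : IsConformalFactor F F' f ρ) (hn : 0 < n) (u : M → ℝ) :
    energy F' (u ∘ f.symm) ≤ energy F u := by
  refine le_iInf fun D => le_iInf fun hD => ?_
  refine (iInf_le_of_le (pushCovector f D) (iInf_le _ (hD.push f))).trans ?_
  refine (lintegral_mono' (h.sphereVolume_le hn) le_rfl).trans_eq ?_
  rw [(measurableEmbedding_sphereMap f).lintegral_map,
    lintegral_withDensity_eq_lintegral_mul_non_measurable _ h.measurable_density
      (Filter.Eventually.of_forall fun s => ENNReal.ofReal_lt_top)]
  refine lintegral_congr fun s => ?_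
  rw [Pi.mul_apply, ← ENNReal.ofReal_mul (pow_nonneg (h.pos _).le n), ← mul_pow, h.gradNorm_map]

theorem IsConformalFactor.mem_spaceH (h : IsConformalFactor F F' f ρ) (hn : 0 < n) {u : M → ℝ}
    (hu : u ∈ spaceH F) : u ∘ f.symm ∈ spaceH F' := by
  obtain ⟨h1, ⟨D, h2⟩, h3⟩ := hu
  exact ⟨h1.comp f.symm.continuous, ⟨_, h2.push f⟩, (h.energy_le hn u).trans_lt h3⟩

theorem IsConformalFactor.mem_spaceH₀ (h : IsConformalFactor F F' f ρ) (hn : 0 < n) {u : M → ℝ}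
    (hu : u ∈ spaceH₀ F) : u ∘ f.symm ∈ spaceH₀ F' := by
  refine ⟨h.mem_spaceH hn hu.1, ?_⟩
  have h1 := hu.2.comp_homeomorph (sphereHomeomorph f).symm
  convert! h1 using 1
  funext s
  exact congrArg u (proj_sphereMap f.symm s).symm

theorem IsConformalFactor.capacity_le (h : IsConformalFactor F F' f ρ) (hn : 0 < n) (C : Set M) :
    capacity F' (f '' C) ≤ capacity F C := by
  refine le_iInf fun u => le_iInf fun ⟨hu, h1, h2⟩ => ?_
  refine (iInf₂_le (u ∘ f.symm) ⟨h.mem_spaceH₀ hn hu, ?_, fun x => h2 _⟩).trans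
    (h.energy_le hn u)
  rintro _ ⟨x, hx, rfl⟩
  simpa using h1 x hx

theorem IsConformalFactor.condenserCapacity_le (h : IsConformalFactor F F' f ρ) (hn : 0 < n)
    (C₀ C₁ : Set M) :
    condenserCapacity F' (f '' C₀) (f '' C₁) ≤ condenserCapacity F C₀ C₁ := by
  refine le_iInf fun u => le_iInf fun ⟨hu, h0, h1, h2⟩ => ?_
  refine (iInf₂_le (u ∘ f.symm)
    ⟨h.mem_spaceH hn hu, ?_, ?_, fun x => h2 _⟩).trans (h.energy_le hn u)
  · rintro _ ⟨x, hx, rfl⟩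
    simpa using h0 x hx
  · rintro _ ⟨x, hx, rfl⟩
    simpa using h1 x hx

end Energy

end

theorem theorem1 (n : ℕ) (hn : 2 ≤ n)
    {M : Type*} [TopologicalSpace M] [T2Space M] [SecondCountableTopology M] [ConnectedSpace M]
    [ChartedSpace (Eu n) M] [IsManifold (𝓡 n) ∞ M]
    {M' : Type*} [TopologicalSpace M'] [T2Space M'] [SecondCountableTopology M']
    [ConnectedSpace M'] [ChartedSpace (Eu n) M'] [IsManifold (𝓡 n) ∞ M']
    (F : FinslerStructure n M) (F' : FinslerStructure n M')
    (f : M ≃ₘ^∞⟮𝓡 n, 𝓡 n⟯ M') (hf : IsConformal F F' f) :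
    (∀ C : Set M, IsCompact C → capacity F C = capacity F' (f '' C)) ∧
      ∀ C₀ C₁ : Set M, IsClosed C₀ → IsClosed C₁ →
        condenserCapacity F C₀ C₁ = condenserCapacity F' (f '' C₀) (f '' C₁) := by
  obtain ⟨ρ, h⟩ := hf.exists_factor hn
  have hn0 : 0 < n := by omega
  refine ⟨fun C _ => le_antisymm ?_ (h.capacity_le hn0 C),
    fun C₀ C₁ _ _ => le_antisymm ?_ (h.condenserCapacity_le hn0 C₀ C₁)⟩
  · simpa only [f.symm_image_image] using h.symm.capacity_le hn0 (f '' C)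
  · simpa only [f.symm_image_image] using h.symm.condenserCapacity_le hn0 (f '' C₀) (f '' C₁)
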